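/- **The Preparation Lemma.** Let $\mathbb K$ be a field with a valuation $\mathrm{val}:\mathbb K\to\mathbb R\cup\{-\infty\}$ (maximum convention: $\mathrm{val}(ab)=\mathrm{val}(a)+\mathrm{val}(b)$, $\mathrm{val}(a+b)\le\max(\mathrm{val}(a),\mathrm{val}(b))$, $\mathrm{val}(a)=-\infty$ iff $a=0$). Let $\mathcal A\subset\mathbb Z^2$ be finite and non-empty, $F(x,y)=\sum_{(i,j)\in\mathcal A}a_{ij}x^iy^j$ with all $a_{ij}\in\mathbb K^*$, and let $C$ be the curve $F=0$. *Tropical notions.* For $Q=(X,Y)\in\mathbb R^2$ let $\mathcal A(Q)$ be the set of $(i,j)\in\mathcal A$ at which $\mathrm{val}(a_{ij})+iX+jY$ is maximal, and let $d(Q)$ be the convex hull of $\mathcal A(Q)$; these polygons form the subdivision of the Newton polygon of $F$ dual to the tropical curve $\mathrm{Val}(C)=\{Q:|\mathcal A(Q)|\ge 2\}$. A vertex of $\mathrm{Val}(C)$ is a point $Q$ with $d(Q)$ two-dimensional; an edge is a closed cell $\{Q:\mathcal A(R)\subseteq\mathcal A(Q)\}$ with $d(R)$ one-dimensional. *Widths.*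 For $u\in\mathbb Z^2$ and a non-empty finite set $B\subset\mathbb Z^2$ put $\omega_u(B)=\max_{x,y\in B}u\cdot(x-y)$ and $\mathrm{def}_u(B)=\max(m-\omega_u(B),0)$. For a vertex $Q$ write $\omega_u(d(Q))=\omega_u(\mathcal A(Q))$ and likewise $\mathrm{def}_u(d(Q))$. *Influence.* For a direction $u\in\mathbb Z^2\setminus\{0\}$ let $X$ be the connected component containing $P$ of the intersection of $\mathrm{Val}(C)$ with the line through $P$ of direction $u$. Let $\mathrm{infl}_u(P)$ be the (finite) set of vertices of $\mathrm{Val}(C)$ that lie on edges of $\mathrm{Val}(C)$ contained in $X$. *Statement.* Let $p=(p_1,p_2)\in(\mathbb K^*)^2$ be a point of multiplicity $m$ of $C$ (that is, the leading term of the Taylor expansion of $F$ at $p$ has degree $m$), and suppose that $C$ is admissible, i.e. $\omega_u(\mathcal A)\ge m$ for every $u\in\mathbb Z^2\setminus\{0\}$. Suppose that $P=(\mathrm{val}(p_1),\mathrm{val}(p_2))$ is a vertex of $\mathrm{Val}(C)$ lying on an edge of direction $u\in\mathbb Z^2\setminus\{0\}$, and that $a:=\omega_u(d(P))<m$. Then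 $$\sum_{Q\in \mathrm{infl}_u(P),\,Q\ne P}\mathrm{area}(d(Q))\ \ge\ \tfrac12\,\mathrm{def}_u(d(P))^2=\tfrac12(m-a)^2 .$$ -/

import Mathlib

open scoped WithZero

noncomputable section

namespace TropicalPlane

/-- A Laurent polynomial `F = ∑ a_ij x^i y^j` in two variables, given by its coefficient
function `(i, j) ↦ a_ij`; the finite set `𝒜` of exponents is `F.support`. -/
abbrev LaurentPoly (K : Type*) [Field K] := (ℤ × ℤ) →₀ K

/-- The coefficient of `s ^ k * t ^ l` in the Taylor expansion of `F (x + s, y + t)` at a point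
`(x, y)` with nonzero coordinates. (One has `(x + s) ^ i = ∑ₖ (i choose k) x ^ (i - k) s ^ k` for
every integer `i`, with the generalized binomial coefficients `Ring.choose`.) -/
def taylorCoeff {K : Type*} [Field K] (F : LaurentPoly K) (x y : K) (k l : ℕ) : K :=
  ∑ q ∈ F.support, F q * ((Ring.choose q.1 k : ℤ) : K) * ((Ring.choose q.2 l : ℤ) : K)
    * x ^ (q.1 - k) * y ^ (q.2 - l)

/-- `(x, y)` is a point of multiplicity `m` of the curve `F = 0`: the leading term of the Taylor
expansion of `F` at `(x, y)` has degree `m`. -/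
def HasMultiplicity {K : Type*} [Field K] (F : LaurentPoly K) (x y : K) (m : ℕ) : Prop :=
  (∀ k l : ℕ, k + l < m → taylorCoeff F x y k l = 0) ∧
    ∃ k l : ℕ, k + l = m ∧ taylorCoeff F x y k l ≠ 0

/-- The pairing `u · q` on `ℤ²`. -/
def dot (u q : ℤ × ℤ) : ℤ := u.1 * q.1 + u.2 * q.2

/-- The lattice width `ω_u(B) = max_{x, y ∈ B} u · (x - y)` of a nonempty finite set `B`. -/
def latticeWidth (u : ℤ × ℤ) (B : Finset (ℤ × ℤ)) : ℤ :=
  sSup {n : ℤ | ∃ x ∈ B, ∃ y ∈ B, n = dot u (x - y)}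

/-- The defect `def_u(B) = max (m - ω_u(B), 0)`. -/
def defect (m : ℕ) (u : ℤ × ℤ) (B : Finset (ℤ × ℤ)) : ℤ :=
  max ((m : ℤ) - latticeWidth u B) 0

/-- The curve `F = 0` is admissible (for `m`): its exponent set has lattice width at least `m`
in every direction. -/
def Admissible {K : Type*} [Field K] (F : LaurentPoly K) (m : ℕ) : Prop :=
  ∀ u : ℤ × ℤ, u ≠ 0 → (m : ℤ) ≤ latticeWidth u F.support

/-- The inclusion `ℤ² ⊆ ℝ²`. -/
def toPlane (q : ℤ × ℤ) : ℝ × ℝ := ((q.1 : ℝ), (q.2 : ℝ))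

section Valued

variable {K : Type*} [Field K] (v : Valuation K ℝᵐ⁰)

/-- The valuation `val : K → ℝ ∪ {-∞}` in additive notation (maximum convention), on nonzero
elements; it is only used there. -/
def val (a : K) : ℝ := WithZero.log (v a)

/-- The tropical monomial `val(a_ij) + i X + j Y` at the point `Q = (X, Y)`. -/
def tropMonomial (F : LaurentPoly K) (q : ℤ × ℤ) (Q : ℝ × ℝ) : ℝ :=
  val v (F q) + (q.1 : ℝ) * Q.1 + (q.2 : ℝ) * Q.2

open scoped Classical in
/-- The exponents in `𝒜` whose tropical monomials attain the maximum `Val(F)(Q)`. These are the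
points of `𝒜` that span the cell `d(Q)` of the subdivision of the Newton polygon. -/
def dualPoints (F : LaurentPoly K) (Q : ℝ × ℝ) : Finset (ℤ × ℤ) :=
  F.support.filter fun q => ∀ r ∈ F.support, tropMonomial v F r Q ≤ tropMonomial v F q Q

/-- The cell `d(Q)` of the subdivision of the Newton polygon that is dual to `Q`. -/
def dualFace (F : LaurentPoly K) (Q : ℝ × ℝ) : Set (ℝ × ℝ) :=
  convexHull ℝ (toPlane '' (dualPoints v F Q : Set (ℤ × ℤ)))

/-- The tropical curve `Val(C)`: the points of the plane where the maximum
`Val(F) = max (val(a_ij) + i X + j Y)` is attained at least twice. -/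
def tropCurve (F : LaurentPoly K) : Set (ℝ × ℝ) :=
  {Q | (dualPoints v F Q : Set (ℤ × ℤ)).Nontrivial}

/-- `Q` is a vertex of `Val(C)`: its dual cell `d(Q)` is two-dimensional. -/
def IsVertex (F : LaurentPoly K) (Q : ℝ × ℝ) : Prop :=
  ¬ Collinear ℝ (toPlane '' (dualPoints v F Q : Set (ℤ × ℤ)))

/-- `E` is an edge of `Val(C)`: it is the closed cell of `Val(C)` dual to a one-dimensional cell
`d(R)` of the subdivision, that is, the set of points where all the tropical monomials that are
maximal at `R` are maximal. -/
def IsEdge (F : LaurentPoly K) (E : Set (ℝ × ℝ)) : Prop :=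
  ∃ R ∈ tropCurve v F, ¬ IsVertex v F R ∧ E = {Q | dualPoints v F R ⊆ dualPoints v F Q}

/-- The line through `P` in the direction `u`. -/
def lineThrough (P : ℝ × ℝ) (u : ℤ × ℤ) : Set (ℝ × ℝ) :=
  {Q | ∃ t : ℝ, Q = P + t • toPlane u}

/-- `dep_u(P)`: the edges of `Val(C)` that lie in the connected component of `P` in the
intersection of `Val(C)` with the line through `P` in the direction `u`. -/
def dep (F : LaurentPoly K) (u : ℤ × ℤ) (P : ℝ × ℝ) : Set (Set (ℝ × ℝ)) :=
  {E | IsEdge v F E ∧ E ⊆ connectedComponentIn (tropCurve v F ∩ lineThrough P u) P}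

/-- `infl_u(P)`: the vertices of `Val(C)` that lie on edges in `dep_u(P)`. -/
def infl (F : LaurentPoly K) (u : ℤ × ℤ) (P : ℝ × ℝ) : Set (ℝ × ℝ) :=
  {Q | IsVertex v F Q ∧ ∃ E ∈ dep v F u P, Q ∈ E}

end Valued

/-- The area of a plane set. -/
def area (S : Set (ℝ × ℝ)) : ℝ := MeasureTheory.volume.real S

end TropicalPlane

end

open scoped WithZero

/-! Give each exponent `q` the height `h q`, the value of its tropical monomial at `P`, and project
along the functional `u · q`. The upper concave hull of the projected heights has superlevel sets
that are intervals; let `W μ` be the length of the one at level `μ` (`levelWidth`). The top level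
set is the projection of `d(P)`, of length `a`, and by admissibility `W` reaches the value `m` or
more at low levels. The edges of the hull of slope `-t` correspond to points `P + t u`, and `d(P + t
u)` projects onto the edge.

Multiplicity enters through one algebraic fact: the terms of `F` at `p`, weighted by an
integer-valued polynomial of degree less than `m`, sum to zero. By the ultrametric inequality no
such polynomial can isolate a term from all others at least as large. Applied to a product of two
binomial coefficients, this shows that an end column of `d(P + t u)`, at height `μ`, has lattice
length at least `m - W μ` (`ColumnBound`). While `W μ < m` these columns are nondegenerate, so the
line from `P` stays in the tropical curve and the vertices met belong to `infl_u(P)`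
(`mem_infl_of_levelWidth_lt`).

For the area, each cell contains the trapezoid spanned by its two end columns. Since `W` is concave,
the interpolated column length over `x` is at least `m - W ν`, where `ν` is the height of the hull
at `x`. For `0 < σ < m - a` choose `μ` with `W μ = m - σ`: up to finitely many points, the slices of
the trapezoids at height `σ` cover the superlevel interval outside the projection of `d(P)`, a set
of length at least `m - a - σ` (`exists_layer`, used on both sides of `P`). Integration over `σ`
gives `(m - a)² / 2`. -/

namespace TropicalPlane

/-! ### Integer-valued polynomials of bounded degree -/

/-- The integer-valued functions on `ℤ²` spanned by the products of binomial coefficients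
`(i choose k) (j choose l)` with `k + l ≤ n`. -/
def binomialSpan (n : ℕ) : Submodule ℤ (ℤ × ℤ → ℤ) :=
  Submodule.span ℤ {f | ∃ k l : ℕ, k + l ≤ n ∧ f = fun q => Ring.choose q.1 k * Ring.choose q.2 l}

/-- Vandermonde applied to `n = (n - k) + k`, followed by `(n choose k) (n - k choose i) = (k + i
choose k) (n choose k + i)`. It expands a product in the binomial basis with integer coefficients,
so no division is needed and every characteristic is covered. -/
theorem choose_mul_choose_eq_sum (n : ℤ) (j k : ℕ) :
    Ring.choose n j * Ring.choose n k = ∑ ij ∈ Finset.HasAntidiagonal.antidiagonal j,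
      (Ring.choose (k : ℤ) ij.2 * ((k + ij.1).choose k : ℤ)) * Ring.choose n (k + ij.1) := by
  have h1 : Ring.choose n j = ∑ ij ∈ Finset.HasAntidiagonal.antidiagonal j,
      Ring.choose (n - k) ij.1 * Ring.choose (k : ℤ) ij.2 := by
    rw [← Ring.add_choose_eq j (Commute.all _ _), sub_add_cancel]
  rw [h1, Finset.sum_mul]
  refine Finset.sum_congr rfl fun ij _ => ?_
  have h2 := Ring.choose_smul_choose n (Nat.le_add_right k ij.1)
  rw [Nat.add_sub_cancel_left, nsmul_eq_mul] at h2
  linear_combination -(Ring.choose (k : ℤ) ij.2) * h2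

theorem binomialSpan_mul_mem {a b : ℕ} {f g : ℤ × ℤ → ℤ} (hf : f ∈ binomialSpan a)
    (hg : g ∈ binomialSpan b) : f * g ∈ binomialSpan (a + b) := by
  induction hf using Submodule.span_induction with
  | zero => simp
  | add x y _ _ hx hy => rw [add_mul]; exact add_mem hx hy
  | smul c x _ hx => rw [smul_mul_assoc]; exact Submodule.smul_mem _ _ hx
  | mem f hf =>
    obtain ⟨k, l, hkl, rfl⟩ := hf
    induction hg using Submodule.span_induction with
    | zero => simp
    | add x y _ _ hx hy => rw [mul_add]; exact add_mem hx hy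
    | smul c x _ hx => rw [mul_smul_comm]; exact Submodule.smul_mem _ _ hx
    | mem g hg =>
      obtain ⟨k', l', hkl', rfl⟩ := hg
      have : (fun q : ℤ × ℤ => Ring.choose q.1 k * Ring.choose q.2 l) *
          (fun q : ℤ × ℤ => Ring.choose q.1 k' * Ring.choose q.2 l') =
          ∑ x ∈ Finset.HasAntidiagonal.antidiagonal k, ∑ y ∈ Finset.HasAntidiagonal.antidiagonal l,
            ((Ring.choose (k' : ℤ) x.2 * ((k' + x.1).choose k' : ℤ)) *
              (Ring.choose (l' : ℤ) y.2 * ((l' + y.1).choose l' : ℤ))) •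
              (fun q : ℤ × ℤ => Ring.choose q.1 (k' + x.1) * Ring.choose q.2 (l' + y.1)) := by
        funext q
        have hx := choose_mul_choose_eq_sum q.1 k k'
        have hy := choose_mul_choose_eq_sum q.2 l l'
        simp only [Pi.mul_apply, Finset.sum_apply, Pi.smul_apply, smul_eq_mul]
        rw [mul_mul_mul_comm, hx, hy, Finset.sum_mul_sum]
        refine Finset.sum_congr rfl fun x _ => Finset.sum_congr rfl fun y _ => by ring
      rw [this]
      refine Submodule.sum_mem _ fun x hx => Submodule.sum_mem _ fun y hy =>
        Submodule.smul_mem _ _ (Submodule.subset_span ⟨_, _, ?_, rfl⟩)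
      rw [Finset.HasAntidiagonal.mem_antidiagonal] at hx hy
      omega

theorem const_mem_binomialSpan (c : ℤ) (n : ℕ) : (fun _ => c) ∈ binomialSpan n := by
  have : (fun _ => c : ℤ × ℤ → ℤ) =
      c • fun q : ℤ × ℤ => Ring.choose q.1 0 * Ring.choose q.2 0 := by
    funext q; simp
  rw [this]
  exact Submodule.smul_mem _ _ (Submodule.subset_span ⟨0, 0, by simp, rfl⟩)

theorem choose_add_mem_binomialSpan {s t : ℤ × ℤ → ℤ}
    (hs : ∀ k, (fun q => Ring.choose (s q) k) ∈ binomialSpan k)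
    (ht : ∀ k, (fun q => Ring.choose (t q) k) ∈ binomialSpan k) (k : ℕ) :
    (fun q => Ring.choose (s q + t q) k) ∈ binomialSpan k := by
  have : (fun q => Ring.choose (s q + t q) k) = ∑ ij ∈ Finset.HasAntidiagonal.antidiagonal k,
      (fun q => Ring.choose (s q) ij.1) * (fun q => Ring.choose (t q) ij.2) := by
    funext q
    simp [Ring.add_choose_eq k (Commute.all (s q) (t q))]
  rw [this]
  refine Submodule.sum_mem _ fun ij hij => ?_
  rw [← Finset.HasAntidiagonal.mem_antidiagonal.1 hij]
  exact binomialSpan_mul_mem (hs _) (ht _)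

/-- The functions on `ℤ²` all of whose binomial coefficients `(s choose k)` lie in
`binomialSpan k`. They include the affine linear functions. -/
def binomialLinear : AddSubgroup (ℤ × ℤ → ℤ) where
  carrier := {s | ∀ k, (fun q => Ring.choose (s q) k) ∈ binomialSpan k}
  zero_mem' k := const_mem_binomialSpan (Ring.choose (0 : ℤ) k) k
  add_mem' := choose_add_mem_binomialSpan
  neg_mem' := by
    intro s hs k
    -- Upper negation reduces `-s` to `s` plus a constant, which the additive case already covers.
    have : (fun q => Ring.choose ((-s) q) k) =
        (Int.negOnePow k : ℤ) • fun q => Ring.choose (s q + ((k : ℤ) - 1)) k := by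
      funext q
      have := Ring.choose_neg (s q) k
      simp only [Pi.neg_apply, Pi.smul_apply, this, smul_eq_mul, add_sub_assoc]
      rfl
    rw [this]
    exact Submodule.smul_mem _ _
      (choose_add_mem_binomialSpan hs (fun j => const_mem_binomialSpan _ j) k)

theorem dot_sub_mem_binomialLinear (u : ℤ × ℤ) (c : ℤ) :
    (fun q => dot u q - c) ∈ binomialLinear := by
  have h1 : (fun q : ℤ × ℤ => q.1) ∈ binomialLinear := fun k =>
    Submodule.subset_span ⟨k, 0, by simp, by simp⟩
  have h2 : (fun q : ℤ × ℤ => q.2) ∈ binomialLinear := fun k =>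
    Submodule.subset_span ⟨0, k, by simp, by simp⟩
  have h3 : (fun _ => c : ℤ × ℤ → ℤ) ∈ binomialLinear := fun k => const_mem_binomialSpan _ k
  have : (fun q => dot u q - c) = u.1 • (fun q : ℤ × ℤ => q.1) + u.2 • (fun q : ℤ × ℤ => q.2)
      - fun _ => c := by
    funext q; simp [dot]
  rw [this]
  exact sub_mem (add_mem (zsmul_mem h1 _) (zsmul_mem h2 _)) h3

/-! ### Multiplicity as a vanishing condition on the terms -/

section

variable {K : Type*} [Field K]

/-- A function in `binomialSpan n` with `n < m` annihilates the terms of a Laurent polynomial at a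
point of multiplicity `m`. -/
theorem HasMultiplicity.sum_eq_zero {F : LaurentPoly K} {x y : K} {m n : ℕ} (hx : x ≠ 0)
    (hy : y ≠ 0) (hF : HasMultiplicity F x y m) (hn : n < m) {f : ℤ × ℤ → ℤ}
    (hf : f ∈ binomialSpan n) :
    ∑ q ∈ F.support, F q * x ^ q.1 * y ^ q.2 * (f q : K) = 0 := by
  induction hf using Submodule.span_induction with
  | zero => simp
  | add f g _ _ hf hg =>
    simp only [Pi.add_apply, Int.cast_add, mul_add, Finset.sum_add_distrib, hf, hg, add_zero]
  | smul c f _ hf =>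
    have : ∀ q : ℤ × ℤ, F q * x ^ q.1 * y ^ q.2 * (((c • f) q : ℤ) : K) =
        c * (F q * x ^ q.1 * y ^ q.2 * (f q : K)) := fun q => by
      simp only [Pi.smul_apply, smul_eq_mul, Int.cast_mul]; ring
    simp only [this, ← Finset.mul_sum, hf, mul_zero]
  | mem f hf =>
    obtain ⟨k, l, hkl, rfl⟩ := hf
    have h0 := hF.1 k l (hkl.trans_lt hn)
    have : ∑ q ∈ F.support, F q * x ^ q.1 * y ^ q.2 *
        ((Ring.choose q.1 k * Ring.choose q.2 l : ℤ) : K) =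
        x ^ k * y ^ l * taylorCoeff F x y k l := by
      rw [taylorCoeff, Finset.mul_sum]
      refine Finset.sum_congr rfl fun q _ => ?_
      rw [zpow_sub₀ hx, zpow_sub₀ hy, zpow_natCast, zpow_natCast]
      push_cast
      field_simp
    rw [this, h0, mul_zero]

variable (v : Valuation K ℝᵐ⁰)

theorem map_intCast_le_one (n : ℤ) : v (n : K) ≤ 1 := by
  have h : ∀ k : ℕ, v (k : K) ≤ 1 := fun k => by
    induction k with
    | zero => simp
    | succ k ih => rw [Nat.cast_succ]; exact v.map_add_le ih (by simp)
  obtain ⟨k, rfl | rfl⟩ := n.eq_nat_or_neg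
  · exact_mod_cast h k
  · rw [Int.cast_neg, v.map_neg]; exact_mod_cast h k

theorem val_term {F : LaurentPoly K} {x y : K} (hx : x ≠ 0) (hy : y ≠ 0) {q : ℤ × ℤ}
    (hq : q ∈ F.support) :
    WithZero.log (v (F q * x ^ q.1 * y ^ q.2)) = tropMonomial v F q (val v x, val v y) := by
  have hF : v (F q) ≠ 0 := (v.ne_zero_iff).2 (Finsupp.mem_support_iff.1 hq)
  have hx' : v x ^ q.1 ≠ 0 := zpow_ne_zero _ ((v.ne_zero_iff).2 hx)
  have hy' : v y ^ q.2 ≠ 0 := zpow_ne_zero _ ((v.ne_zero_iff).2 hy)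
  rw [map_mul, map_mul, map_zpow₀, map_zpow₀, WithZero.log_mul (mul_ne_zero hF hx') hy',
    WithZero.log_mul hF hx', WithZero.log_zpow, WithZero.log_zpow, tropMonomial]
  simp [val]

/-- If an integer-valued polynomial of degree less than the multiplicity takes the value `1` at an
exponent `q₀`, then it is nonzero at another exponent whose term is at least as large. -/
theorem HasMultiplicity.exists_ne_zero {F : LaurentPoly K} {x y : K} {m n : ℕ} (hx : x ≠ 0)
    (hy : y ≠ 0) (hF : HasMultiplicity F x y m) (hn : n < m) {f : ℤ × ℤ → ℤ}
    (hf : f ∈ binomialSpan n) {q₀ : ℤ × ℤ} (hq₀ : q₀ ∈ F.support) (hf₀ : f q₀ = 1) :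
    ∃ q ∈ F.support, q ≠ q₀ ∧ f q ≠ 0 ∧
      tropMonomial v F q₀ (val v x, val v y) ≤ tropMonomial v F q (val v x, val v y) := by
  by_contra! hcon
  have h0 := hF.sum_eq_zero hx hy hn hf
  rw [← Finset.add_sum_erase _ _ hq₀, hf₀, Int.cast_one, mul_one] at h0
  have hne : ∀ q ∈ F.support, v (F q * x ^ q.1 * y ^ q.2) ≠ 0 := fun q hq =>
    (v.ne_zero_iff).2 (mul_ne_zero (mul_ne_zero (Finsupp.mem_support_iff.1 hq)
      (zpow_ne_zero _ hx)) (zpow_ne_zero _ hy))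
  -- Integers have valuation at most `1`, so each remaining weighted term is strictly smaller than
  -- the term at `q₀`; yet their sum is its negative.
  have h1 : v (∑ q ∈ F.support.erase q₀, F q * x ^ q.1 * y ^ q.2 * (f q : K)) <
      v (F q₀ * x ^ q₀.1 * y ^ q₀.2) := by
    refine v.map_sum_lt (hne _ hq₀) fun q hq => ?_
    rw [Finset.mem_erase] at hq
    by_cases hfq : f q = 0
    · simpa [hfq] using zero_lt_iff.2 (hne _ hq₀)
    · rw [map_mul]
      refine (mul_le_of_le_one_right' (map_intCast_le_one v _)).trans_lt ?_
      rw [← WithZero.log_lt_log (hne _ hq.2) (hne _ hq₀), val_term v hx hy hq.2,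
        val_term v hx hy hq₀]
      exact hcon q hq.2 hq.1 hfq
  rw [eq_neg_of_add_eq_zero_left h0, v.map_neg] at h1
  exact lt_irrefl _ h1

theorem choose_int_eq_zero {n : ℤ} {k : ℕ} (h0 : 0 ≤ n) (h : n < k) : Ring.choose n k = 0 := by
  lift n to ℕ using h0
  rw [Ring.choose_natCast, Nat.choose_eq_zero_of_lt (by exact_mod_cast h), Nat.cast_zero]

/-- Let all the terms that are at least as large as `q₁` lie in the strip `c' ≤ u · q ≤ c`, and
let those on the line `u · q = c` lie between `q₀` and `q₁`. Then the width of the strip plus the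
length from `q₀` to `q₁` is at least the multiplicity. -/
theorem HasMultiplicity.le_width_add_length {F : LaurentPoly K} {x y : K} {m : ℕ} (hx : x ≠ 0)
    (hy : y ≠ 0) (hF : HasMultiplicity F x y m) {u w : ℤ × ℤ} (huw : u.1 * w.2 - u.2 * w.1 = 1)
    {c c' : ℤ} (hc : c' ≤ c) {q₀ q₁ : ℤ × ℤ} (hq₁ : q₁ ∈ F.support) (h₁ : dot u q₁ = c)
    (h₀₁ : dot w q₀ ≤ dot w q₁)
    (hstrip : ∀ q ∈ F.support, tropMonomial v F q₁ (val v x, val v y) ≤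
      tropMonomial v F q (val v x, val v y) → c' ≤ dot u q ∧ dot u q ≤ c ∧
        (dot u q = c → dot w q₀ ≤ dot w q ∧ dot w q ≤ dot w q₁)) :
    (m : ℤ) ≤ (c - c') + (dot w q₁ - dot w q₀) := by
  by_contra! hlt
  obtain ⟨k, hk⟩ := Int.eq_ofNat_of_zero_le (sub_nonneg.2 hc)
  obtain ⟨l, hl⟩ := Int.eq_ofNat_of_zero_le (sub_nonneg.2 h₀₁)
  -- With `k = c - c'` and `l` the length from `q₀` to `q₁`, the first factor vanishes on the
  -- columns `c' ≤ u · q < c`, and the second on the part of the last column before `q₁`. Among the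
  -- competing terms only `q₁` survives, with value `1`.
  have hf : ((fun q => Ring.choose (dot u q - c') k) * fun q => Ring.choose (dot w q - dot w q₀) l)
      ∈ binomialSpan (k + l) :=
    binomialSpan_mul_mem (dot_sub_mem_binomialLinear u c' k)
      (dot_sub_mem_binomialLinear w (dot w q₀) l)
  obtain ⟨q, hq, hne, hfq, hle⟩ := hF.exists_ne_zero v hx hy (by omega) hf hq₁ (by
    simp only [Pi.mul_apply, h₁, hk, hl, Ring.choose_natCast, Nat.choose_self]; simp)
  obtain ⟨hq1, hq2, hq3⟩ := hstrip q hq hle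
  simp only [Pi.mul_apply] at hfq
  have hec : dot u q = c := by
    by_contra hne'
    exact hfq (by rw [choose_int_eq_zero (by omega) (by omega), zero_mul])
  have hb : dot w q = dot w q₁ := by
    by_contra hne'
    obtain ⟨h5, h6⟩ := hq3 hec
    exact hfq (by rw [choose_int_eq_zero (n := dot w q - _) (by omega) (by omega), mul_zero])
  refine hne ?_
  rw [← h₁] at hec
  simp only [dot] at hec hb
  ext
  · linear_combination w.2 * hec - u.2 * hb - (q.1 - q₁.1) * huw
  · linear_combination u.1 * hb - w.1 * hec - (q.2 - q₁.2) * huw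

end

/-! ### Superlevel sets of the upper concave hull -/

section Reach

variable (A : Finset (ℤ × ℤ)) (h : ℤ × ℤ → ℝ) (u : ℤ × ℤ)

/-- The maximum over `A` of the affine functions `t ↦ h q + t (u · q)`. -/
noncomputable def maxAlong (t : ℝ) : ℝ := ⨆ q : A, (h q + t * dot u q)

/-- The largest height over `A`. -/
noncomputable def maxHeight : ℝ := ⨆ q : A, h q

/-- The right end, in the direction `u`, of the superlevel set `≥ μ` of the upper concave hull
of the heights `h`. -/
noncomputable def reach (μ : ℝ) : ℝ := ⨅ t : Set.Ioi (0 : ℝ), (maxAlong A h u t - μ) / t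

/-- The length, in the direction `u`, of the superlevel set `≥ μ` of the upper concave hull of
the heights `h`. -/
noncomputable def levelWidth (μ : ℝ) : ℝ := reach A h u μ + reach A h (-u) μ

variable {A h u}

theorem dot_neg (q : ℤ × ℤ) : dot (-u) q = -dot u q := by simp [dot]; ring

theorem levelWidth_neg (μ : ℝ) : levelWidth A h (-u) μ = levelWidth A h u μ := by
  rw [levelWidth, levelWidth, neg_neg, add_comm]

theorem le_maxAlong {q : ℤ × ℤ} (hq : q ∈ A) (t : ℝ) : h q + t * dot u q ≤ maxAlong A h u t :=
  le_ciSup (f := fun q : A => h q + t * dot u q) (Set.finite_range _).bddAbove ⟨q, hq⟩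

theorem maxAlong_le (hA : A.Nonempty) {t c : ℝ} (hc : ∀ q ∈ A, h q + t * dot u q ≤ c) :
    maxAlong A h u t ≤ c :=
  have : Nonempty A := hA.to_subtype
  ciSup_le fun q => hc q q.2

theorem le_maxHeight {q : ℤ × ℤ} (hq : q ∈ A) : h q ≤ maxHeight A h :=
  le_ciSup (f := fun q : A => h q) (Set.finite_range _).bddAbove ⟨q, hq⟩

theorem exists_eq_maxHeight (hA : A.Nonempty) (h : ℤ × ℤ → ℝ) : ∃ q ∈ A, h q = maxHeight A h := by
  have : Nonempty A := hA.to_subtype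
  obtain ⟨q, hq⟩ := exists_eq_ciSup_of_finite (f := fun q : A => h q)
  exact ⟨q, q.2, hq⟩

theorem le_div_of_le {q : ℤ × ℤ} (hq : q ∈ A) {μ : ℝ} (hμ : μ ≤ h q) {t : ℝ} (ht : 0 < t) :
    (dot u q : ℝ) ≤ (maxAlong A h u t - μ) / t := by
  rw [le_div_iff₀ ht]
  linarith [le_maxAlong (h := h) (u := u) hq t]

theorem le_reach {q : ℤ × ℤ} (hq : q ∈ A) {μ : ℝ} (hμ : μ ≤ h q) :
    (dot u q : ℝ) ≤ reach A h u μ :=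
  le_ciInf fun t => le_div_of_le hq hμ t.2

/-- The bound on `μ` matters: a point of maximal height then bounds the family below, so that `⨅` is
a true infimum and not the default value `0`. -/
theorem reach_le (hA : A.Nonempty) {μ : ℝ} (hμ : μ ≤ maxHeight A h) {t : ℝ} (ht : 0 < t) :
    reach A h u μ ≤ (maxAlong A h u t - μ) / t := by
  obtain ⟨q, hq, hqM⟩ := exists_eq_maxHeight hA h
  refine ciInf_le (f := fun t : Set.Ioi (0 : ℝ) => (maxAlong A h u t - μ) / t)
    ⟨dot u q, ?_⟩ ⟨t, ht⟩
  rintro _ ⟨s, rfl⟩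
  exact le_div_of_le hq (hqM ▸ hμ) s.2

theorem reach_anti (hA : A.Nonempty) {μ ν : ℝ} (hμν : μ ≤ ν) (hν : ν ≤ maxHeight A h) :
    reach A h u ν ≤ reach A h u μ :=
  le_ciInf fun t => (reach_le hA hν t.2).trans
    (div_le_div_of_nonneg_right (by linarith) (le_of_lt t.2))

theorem levelWidth_anti (hA : A.Nonempty) {μ ν : ℝ} (hμν : μ ≤ ν) (hν : ν ≤ maxHeight A h) :
    levelWidth A h u ν ≤ levelWidth A h u μ :=
  add_le_add (reach_anti hA hμν hν) (reach_anti hA hμν hν)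

/-- An infimum of affine functions of `μ` is concave. -/
theorem concaveOn_reach (hA : A.Nonempty) (h : ℤ × ℤ → ℝ) (u : ℤ × ℤ) :
    ConcaveOn ℝ (Set.Iic (maxHeight A h)) (reach A h u) := by
  refine ⟨convex_Iic _, fun x hx y hy a b ha hb hab => le_ciInf fun t => ?_⟩
  have ht : (0 : ℝ) < t := t.2
  have h1 := reach_le (u := u) hA hx ht
  have h2 := reach_le (u := u) hA hy ht
  rw [le_div_iff₀ ht] at h1 h2 ⊢
  simp only [smul_eq_mul]
  have h3 : a * maxAlong A h u t + b * maxAlong A h u t = maxAlong A h u t := by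
    rw [← add_mul, hab, one_mul]
  linarith [mul_le_mul_of_nonneg_left h1 ha, mul_le_mul_of_nonneg_left h2 hb]

theorem concaveOn_levelWidth (hA : A.Nonempty) (h : ℤ × ℤ → ℝ) (u : ℤ × ℤ) :
    ConcaveOn ℝ (Set.Iic (maxHeight A h)) (levelWidth A h u) :=
  (concaveOn_reach hA h u).add (concaveOn_reach hA h (-u))

/-- Near the maximal height, the superlevel sets of the upper hull are close to the set where the
maximal height is attained. -/
theorem exists_pos_reach_le (hA : A.Nonempty) {a : ℝ}
    (ha : ∀ q ∈ A, h q = maxHeight A h → (dot u q : ℝ) ≤ a) :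
    ∃ t > 0, ∀ μ ≤ maxHeight A h, reach A h u μ ≤ a + (maxHeight A h - μ) / t := by
  -- For small `t > 0` the finitely many points below the maximal height cannot overtake it.
  have hev : ∀ᶠ t : ℝ in nhdsWithin 0 (Set.Ioi 0), ∀ q ∈ A,
      h q + t * dot u q ≤ maxHeight A h + t * a := by
    rw [Finset.eventually_all]
    intro q hq
    rcases (le_maxHeight (h := h) hq).eq_or_lt with heq | hlt
    · filter_upwards [self_mem_nhdsWithin] with t ht
      rw [heq]
      have := mul_le_mul_of_nonneg_left (ha q hq heq) (le_of_lt ht)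
      linarith
    · have hc : ContinuousAt (fun t : ℝ => h q + t * dot u q - t * a) 0 := by fun_prop
      have := (hc.eventually_lt (g := fun _ => maxHeight A h) continuousAt_const
        (by simpa using hlt)).filter_mono (nhdsWithin_le_nhds (s := Set.Ioi 0))
      filter_upwards [this] with t ht
      linarith
  obtain ⟨t, ht, ht0⟩ := (hev.and self_mem_nhdsWithin).exists
  refine ⟨t, ht0, fun μ hμ => (reach_le hA hμ ht0).trans ?_⟩
  have h1 := maxAlong_le hA ht
  have ht0' : (0 : ℝ) < t := ht0
  rw [div_le_iff₀ ht0', add_mul, div_mul_cancel₀ _ ht0'.ne']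
  linarith

/-- Intermediate value theorem: the width is close to at most `a + a'` near the top, at least `w`
once the level is below both `q₁` and `q₂`, and continuous in between because it is concave. -/
theorem exists_levelWidth_eq (hA : A.Nonempty) {a a' w : ℝ}
    (ha : ∀ q ∈ A, h q = maxHeight A h → (dot u q : ℝ) ≤ a)
    (ha' : ∀ q ∈ A, h q = maxHeight A h → -(dot u q : ℝ) ≤ a') (hw : a + a' < w)
    {q₁ q₂ : ℤ × ℤ} (hq₁ : q₁ ∈ A) (hq₂ : q₂ ∈ A) (hle : w ≤ dot u q₁ - dot u q₂) :
    ∃ μ < maxHeight A h, levelWidth A h u μ = w := by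
  obtain ⟨t, ht, htr⟩ := exists_pos_reach_le hA ha
  obtain ⟨t', ht', htr'⟩ := exists_pos_reach_le (u := -u) (a := a') hA
    (by simpa only [dot_neg, Int.cast_neg] using ha')
  set M := maxHeight A h with hM
  -- At depth `ε` below the top the two reaches exceed `a` and `a'` by at most `ε / t + ε / t'`,
  -- which is exactly the slack `w - (a + a')`.
  set ε : ℝ := (w - (a + a')) / (1 / t + 1 / t') with hε
  have hpos : 0 < 1 / t + 1 / t' := by positivity
  have hε0 : 0 < ε := div_pos (by linarith) hpos
  have hhi : levelWidth A h u (M - ε) ≤ w := by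
    have h1 := htr (M - ε) (by linarith)
    have h2 := htr' (M - ε) (by linarith)
    have h3 : ε * (1 / t + 1 / t') = w - (a + a') := div_mul_cancel₀ _ hpos.ne'
    rw [sub_sub_cancel] at h1 h2
    rw [levelWidth]
    have h4 : ε / t + ε / t' = ε * (1 / t + 1 / t') := by ring
    linarith
  set μ₀ := min (M - ε) (min (h q₁) (h q₂)) with hμ₀
  have hlo : w ≤ levelWidth A h u μ₀ := by
    have h1 : (dot u q₁ : ℝ) ≤ reach A h u μ₀ :=
      le_reach hq₁ ((min_le_right _ _).trans (min_le_left _ _))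
    have h2 : (dot (-u) q₂ : ℝ) ≤ reach A h (-u) μ₀ :=
      le_reach hq₂ ((min_le_right _ _).trans (min_le_right _ _))
    rw [dot_neg, Int.cast_neg] at h2
    rw [levelWidth]
    linarith
  have hcont : ContinuousOn (levelWidth A h u) (Set.Icc μ₀ (M - ε)) :=
    (((concaveOn_levelWidth hA h u).subset Set.Iio_subset_Iic_self (convex_Iio _)).continuousOn
      isOpen_Iio).mono fun x hx => lt_of_le_of_lt hx.2 (by linarith)
  obtain ⟨μ, hμ, hμw⟩ := intermediate_value_Icc' (min_le_left _ _) hcont ⟨hhi, hlo⟩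
  exact ⟨μ, lt_of_le_of_lt hμ.2 (by linarith), hμw⟩

/-- The points beyond the top of the upper hull in the direction `u` lie over an edge of the hull
of negative slope. -/
theorem exists_pos_eq_maxAlong (hA : A.Nonempty) {x μ : ℝ} (hμ : μ ≤ maxHeight A h)
    (hx : ∀ q ∈ A, (dot u q : ℝ) ≠ x)
    (htop : ∀ q ∈ A, h q = maxHeight A h → (dot u q : ℝ) < x) (hxμ : x < reach A h u μ) :
    ∃ t > 0, ∃ q₁ ∈ A, ∃ q₂ ∈ A, h q₁ + t * dot u q₁ = maxAlong A h u t ∧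
      h q₂ + t * dot u q₂ = maxAlong A h u t ∧ (dot u q₁ : ℝ) < x ∧ x < dot u q₂ := by
  classical
  obtain ⟨q₀, hq₀, hq₀M⟩ := exists_eq_maxHeight hA h
  have hq₀x := htop q₀ hq₀ hq₀M
  have hex : ∃ q ∈ A, x < dot u q := by
    by_contra! hcon
    obtain ⟨q', hq', hmax⟩ := A.exists_max_image (fun q => dot u q) hA
    have hlt : (dot u q' : ℝ) < x := lt_of_le_of_ne (hcon q' hq') (hx q' hq')
    have hpos : 0 < x - dot u q' := by linarith
    have hM0 : 0 ≤ maxHeight A h - μ := by linarith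
    -- Large enough that `t (x - u · q')` exceeds `maxHeight A h - μ`, which forces the reach below
    -- `x`.
    set t : ℝ := (maxHeight A h - μ) / (x - dot u q') + 1 with ht
    have ht0 : 0 < t := by positivity
    have h1 := hxμ.trans_le (reach_le (u := u) hA hμ ht0)
    have h2 : maxAlong A h u t ≤ maxHeight A h + t * dot u q' := by
      refine maxAlong_le hA fun q hq => add_le_add (le_maxHeight hq) ?_
      exact mul_le_mul_of_nonneg_left (by exact_mod_cast hmax q hq) ht0.le
    rw [lt_div_iff₀ ht0] at h1
    have h3 : t * (x - dot u q') = (maxHeight A h - μ) + (x - dot u q') := by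
      rw [ht, add_mul, div_mul_cancel₀ _ hpos.ne', one_mul]
    nlinarith
  obtain ⟨q₀', hq₀', hq₀'x⟩ := hex
  -- Among the chords straddling `x`, take one that is highest over `x`. Replacing either endpoint
  -- by another point does not raise it, so all points lie on or below its line, of slope `-t`.
  obtain ⟨⟨q₁, q₂⟩, hmem, hmax⟩ := Finset.exists_max_image
    (A.filter (fun q => (dot u q : ℝ) < x) ×ˢ A.filter (fun q => x < (dot u q : ℝ)))
    (fun p => (h p.1 * (dot u p.2 - x) + h p.2 * (x - dot u p.1)) / (dot u p.2 - dot u p.1))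
    ⟨(q₀, q₀'), by simp [hq₀, hq₀', hq₀x, hq₀'x]⟩
  simp only [Finset.mem_product, Finset.mem_filter] at hmem
  obtain ⟨⟨hq₁, hq₁x⟩, hq₂, hq₂x⟩ := hmem
  have hd : (0 : ℝ) < dot u q₂ - dot u q₁ := by linarith
  set t : ℝ := (h q₁ - h q₂) / (dot u q₂ - dot u q₁) with ht
  have htd : t * (dot u q₂ - dot u q₁) = h q₁ - h q₂ := div_mul_cancel₀ _ hd.ne'
  set C : ℝ := h q₁ + t * dot u q₁ with hC
  have hC1 : h q₁ = C - t * dot u q₁ := by rw [hC]; ring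
  have hC2 : h q₂ = C - t * dot u q₂ := by linarith
  have hval : (h q₁ * (dot u q₂ - x) + h q₂ * (x - dot u q₁)) / (dot u q₂ - dot u q₁) =
      C - t * x := by
    rw [div_eq_iff hd.ne', hC1, hC2]; ring
  have hle : ∀ q ∈ A, h q + t * dot u q ≤ C := by
    intro q hq
    rcases lt_or_gt_of_ne (hx q hq) with hlt | hgt
    · have h1 := hmax (q, q₂) (by simp [hq, hlt, hq₂, hq₂x])
      dsimp only at h1
      rw [hval, div_le_iff₀ (by linarith), hC2] at h1
      have h2 : (h q + t * dot u q - C) * (dot u q₂ - x) ≤ 0 := by linarith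
      have := nonpos_of_mul_nonpos_left h2 (by linarith)
      linarith
    · have h1 := hmax (q₁, q) (by simp [hq, hgt, hq₁, hq₁x])
      dsimp only at h1
      rw [hval, div_le_iff₀ (by linarith), hC1] at h1
      have h2 : (h q + t * dot u q - C) * (x - dot u q₁) ≤ 0 := by linarith
      have := nonpos_of_mul_nonpos_left h2 (by linarith)
      linarith
  have hCN : C = maxAlong A h u t := le_antisymm (le_maxAlong hq₁ t) (maxAlong_le hA hle)
  refine ⟨t, ?_, q₁, hq₁, q₂, hq₂, hCN, by rw [← hCN]; linarith, hq₁x, hq₂x⟩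
  -- The slope is negative: `q₀` lies to the left of `x`, on or below the line, and is still
  -- strictly higher than `q₂`.
  have h1 := hle q₀ hq₀
  have h2 : h q₂ < h q₀ := by
    rw [hq₀M]
    exact lt_of_le_of_ne (le_maxHeight hq₂) fun heq => by linarith [htop q₂ hq₂ heq]
  have h3 : 0 < t * (dot u q₂ - dot u q₀) := by linarith
  exact (pos_iff_pos_of_mul_pos h3).2 (by linarith)

end Reach

/-! ### Column lengths of the dual cells, and membership in the influence set -/

/-- In every direction, the column lengths of the cells dual to the points `P + t u`, `t > 0`, are
at least `m` minus the width of the corresponding superlevel set. -/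
def ColumnBound (A : Finset (ℤ × ℤ)) (h : ℤ × ℤ → ℝ) (m : ℕ) (u w : ℤ × ℤ) : Prop :=
  ∀ t > 0, ∀ q ∈ A, h q + t * dot u q = maxAlong A h u t →
    ∃ q₀ ∈ A, ∃ q₁ ∈ A, h q₀ + t * dot u q₀ = maxAlong A h u t ∧
      h q₁ + t * dot u q₁ = maxAlong A h u t ∧ dot u q₀ = dot u q ∧ dot u q₁ = dot u q ∧
      dot w q₀ ≤ dot w q₁ ∧ (m : ℝ) ≤ levelWidth A h u (h q) + (dot w q₁ - dot w q₀)

theorem ColumnBound.exists_ne {A : Finset (ℤ × ℤ)} {h : ℤ × ℤ → ℝ} {m : ℕ} {u w : ℤ × ℤ}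
    (hcol : ColumnBound A h m u w) {μ s : ℝ} (hW : levelWidth A h u μ < m) (hs : 0 < s)
    {q : ℤ × ℤ} (hq : q ∈ A) (hqs : h q + s * dot u q = maxAlong A h u s) (hμ : μ ≤ h q) :
    ∃ r₀ r₁, (r₀ ∈ A ∧ h r₀ + s * dot u r₀ = maxAlong A h u s) ∧
      (r₁ ∈ A ∧ h r₁ + s * dot u r₁ = maxAlong A h u s) ∧
      dot u r₀ = dot u q ∧ dot u r₁ = dot u q ∧ r₀ ≠ r₁ := by
  obtain ⟨r₀, hr₀, r₁, hr₁, hm₀, hm₁, he₀, he₁, -, hb⟩ := hcol s hs q hq hqs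
  refine ⟨r₀, r₁, ⟨hr₀, hm₀⟩, ⟨hr₁, hm₁⟩, he₀, he₁, ?_⟩
  rintro rfl
  have := levelWidth_anti (u := u) ⟨q, hq⟩ hμ (le_maxHeight hq)
  rw [sub_self, add_zero] at hb
  linarith

section Valued

variable {K : Type*} [Field K] {v : Valuation K ℝᵐ⁰} {F : LaurentPoly K} {P : ℝ × ℝ} {m : ℕ}
  {u w : ℤ × ℤ}

/-- Since `q` maximizes `h + t (u · )` with `t > 0`, a term at least as large as `q` cannot lie to
its right. The competing terms thus fill a strip from the left end of the superlevel set to the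
column of `q`, whose width is at most `levelWidth`. -/
theorem columnBound_of_hasMultiplicity {x y : K} (hx : x ≠ 0) (hy : y ≠ 0)
    (hF : HasMultiplicity F x y m) (huw : u.1 * w.2 - u.2 * w.1 = 1) :
    ColumnBound F.support (fun q => tropMonomial v F q (val v x, val v y)) m u w := by
  intro t ht q hq hqt
  set A := F.support
  set h : ℤ × ℤ → ℝ := fun q => tropMonomial v F q (val v x, val v y) with hh
  set B := A.filter fun r => h r + t * dot u r = maxAlong A h u t ∧ dot u r = dot u q with hB
  have hBne : B.Nonempty := ⟨q, by simp [hB, hq, hqt]⟩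
  obtain ⟨q₀, hq₀, hmin⟩ := B.exists_min_image (dot w) hBne
  obtain ⟨q₁, hq₁, hmax⟩ := B.exists_max_image (dot w) hBne
  have h01 := hmin q₁ hq₁
  rw [hB, Finset.mem_filter] at hq₀ hq₁
  refine ⟨q₀, hq₀.1, q₁, hq₁.1, hq₀.2.1, hq₁.2.1, hq₀.2.2, hq₁.2.2, h01, ?_⟩
  have hq1q : h q₁ = h q := by
    have := hq₁.2.1
    rw [hq₁.2.2] at this
    linarith
  -- The strip needs an integral left end; rounding up loses no exponent, as `u · r` is an integer.
  have hlo : ∀ r ∈ A, h q ≤ h r → ⌈-reach A h (-u) (h q)⌉ ≤ dot u r := fun r hr hle => by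
    have := le_reach (u := -u) hr hle
    rw [dot_neg, Int.cast_neg] at this
    exact Int.ceil_le.2 (by linarith)
  have key := hF.le_width_add_length v hx hy huw (c := dot u q)
    (c' := ⌈-reach A h (-u) (h q)⌉) (hlo q hq le_rfl) hq₁.1 hq₁.2.2 h01 (by
    intro r hr hle
    have hle' : h q ≤ h r := hq1q ▸ hle
    have hrt := le_maxAlong (h := h) (u := u) hr t
    refine ⟨hlo r hr hle', ?_, fun hru => ?_⟩
    · have h1 : t * dot u r ≤ t * dot u q := by linarith
      exact_mod_cast le_of_mul_le_mul_left h1 ht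
    · have hrB : r ∈ B := by
        rw [hB, Finset.mem_filter]
        refine ⟨hr, le_antisymm hrt ?_, hru⟩
        rw [hru]
        linarith
      exact ⟨hmin r hrB, hmax r hrB⟩)
  have key' : (m : ℝ) ≤ (dot u q - ⌈-reach A h (-u) (h q)⌉) + (dot w q₁ - dot w q₀) := by
    exact_mod_cast key
  have h2 := Int.le_ceil (-reach A h (-u) (h q))
  have h3 := le_reach (h := h) (u := u) hq le_rfl
  rw [levelWidth]
  linarith

theorem tropMonomial_add_smul (q : ℤ × ℤ) (t : ℝ) :
    tropMonomial v F q (P + t • toPlane u) = tropMonomial v F q P + t * dot u q := by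
  simp [tropMonomial, toPlane, dot]
  ring

theorem mem_dualPoints {Q : ℝ × ℝ} {q : ℤ × ℤ} : q ∈ dualPoints v F Q ↔
    q ∈ F.support ∧ ∀ r ∈ F.support, tropMonomial v F r Q ≤ tropMonomial v F q Q := by
  rw [dualPoints, Finset.mem_filter]

theorem mem_dualPoints_add_smul {q : ℤ × ℤ} {t : ℝ} :
    q ∈ dualPoints v F (P + t • toPlane u) ↔ q ∈ F.support ∧
      tropMonomial v F q P + t * dot u q =
        maxAlong F.support (fun q => tropMonomial v F q P) u t := by
  rw [mem_dualPoints]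
  simp only [tropMonomial_add_smul]
  refine and_congr_right fun hq => ⟨fun hr => ?_, fun heq r hr => ?_⟩
  · exact le_antisymm (le_maxAlong (h := fun q => tropMonomial v F q P) hq t)
      (maxAlong_le ⟨q, hq⟩ hr)
  · rw [heq]
    exact le_maxAlong (h := fun q => tropMonomial v F q P) hr t

theorem mem_dualPoints_iff_maxHeight {q : ℤ × ℤ} :
    q ∈ dualPoints v F P ↔ q ∈ F.support ∧
      tropMonomial v F q P = maxHeight F.support fun q => tropMonomial v F q P := by
  rw [mem_dualPoints]
  refine and_congr_right fun hq => ⟨fun hr => ?_, fun heq r hr => ?_⟩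
  · obtain ⟨r, hrA, hrM⟩ := exists_eq_maxHeight ⟨q, hq⟩ fun q => tropMonomial v F q P
    exact le_antisymm (le_maxHeight (h := fun q => tropMonomial v F q P) hq) (hrM ▸ hr r hrA)
  · rw [heq]
    exact le_maxHeight (h := fun q => tropMonomial v F q P) hr

theorem dualPoints_nonempty (hF : F.support.Nonempty) (Q : ℝ × ℝ) :
    (dualPoints v F Q).Nonempty := by
  obtain ⟨q, hq, hmax⟩ := F.support.exists_max_image (fun q => tropMonomial v F q Q) hF
  exact ⟨q, mem_dualPoints.2 ⟨hq, hmax⟩⟩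

theorem toPlane_ne_zero (hu : u ≠ 0) : toPlane u ≠ 0 := fun h0 => hu (by
  simp only [toPlane, Prod.mk_eq_zero, Int.cast_eq_zero] at h0
  exact Prod.ext h0.1 h0.2)

theorem collinear_of_dot_eq {S : Set (ℤ × ℤ)} {δ : ℝ × ℝ} (hδ : δ ≠ 0) {c : ℝ}
    (hS : ∀ q ∈ S, δ.1 * q.1 + δ.2 * q.2 = c) : Collinear ℝ (toPlane '' S) := by
  have hpos : 0 < δ.1 ^ 2 + δ.2 ^ 2 := by
    by_contra! hcon
    have h1 : δ.1 = 0 := by nlinarith [sq_nonneg δ.1, sq_nonneg δ.2]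
    have h2 : δ.2 = 0 := by nlinarith [sq_nonneg δ.1, sq_nonneg δ.2]
    exact hδ (Prod.ext h1 h2)
  rw [collinear_iff_exists_forall_eq_smul_vadd]
  refine ⟨(c / (δ.1 ^ 2 + δ.2 ^ 2)) • δ, (-δ.2, δ.1), ?_⟩
  rintro _ ⟨q, hq, rfl⟩
  refine ⟨(δ.1 * q.2 - δ.2 * q.1) / (δ.1 ^ 2 + δ.2 ^ 2), ?_⟩
  have := hS q hq
  ext
  · simp only [toPlane, vadd_eq_add, Prod.fst_add, Prod.smul_fst, smul_eq_mul]
    field_simp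
    rw [← this]; ring
  · simp only [toPlane, vadd_eq_add, Prod.snd_add, Prod.smul_snd, smul_eq_mul]
    field_simp
    rw [← this]; ring

theorem not_collinear_of_dot {S : Set (ℤ × ℤ)} {q₀ q₁ q₂ : ℤ × ℤ} (h₀ : q₀ ∈ S) (h₁ : q₁ ∈ S)
    (h₂ : q₂ ∈ S) (h₀₁ : q₀ ≠ q₁) (hu₁ : dot u q₀ = dot u q₁) (hu₂ : dot u q₀ ≠ dot u q₂) :
    ¬ Collinear ℝ (toPlane '' S) := by
  intro hcol
  rw [collinear_iff_of_mem (Set.mem_image_of_mem toPlane h₀)] at hcol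
  obtain ⟨d, hd⟩ := hcol
  obtain ⟨r₁, hr₁⟩ := hd _ (Set.mem_image_of_mem toPlane h₁)
  obtain ⟨r₂, hr₂⟩ := hd _ (Set.mem_image_of_mem toPlane h₂)
  simp only [toPlane, vadd_eq_add, Prod.ext_iff, Prod.fst_add, Prod.snd_add, Prod.smul_fst,
    Prod.smul_snd, smul_eq_mul] at hr₁ hr₂
  have e₁ : (dot u q₁ : ℝ) = dot u q₀ + r₁ * (u.1 * d.1 + u.2 * d.2) := by
    simp only [dot]; push_cast; rw [hr₁.1, hr₁.2]; ring
  have e₂ : (dot u q₂ : ℝ) = dot u q₀ + r₂ * (u.1 * d.1 + u.2 * d.2) := by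
    simp only [dot]; push_cast; rw [hr₂.1, hr₂.2]; ring
  rw [hu₁] at e₁
  have hr₁0 : r₁ ≠ 0 := by
    rintro rfl
    simp only [zero_mul, zero_add, Int.cast_inj] at hr₁
    exact h₀₁ (Prod.ext hr₁.1.symm hr₁.2.symm)
  have h3 : u.1 * d.1 + u.2 * d.2 = 0 := by
    have h4 : r₁ * (u.1 * d.1 + u.2 * d.2) = 0 := by linarith
    exact (mul_eq_zero.1 h4).resolve_left hr₁0
  rw [h3, mul_zero, add_zero] at e₂
  exact hu₂ (by exact_mod_cast e₂.symm)

theorem IsVertex.nonempty_dualPoints {Q : ℝ × ℝ} (hQ : IsVertex v F Q) :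
    (dualPoints v F Q).Nonempty := by
  by_contra hcon
  rw [Finset.not_nonempty_iff_eq_empty] at hcon
  refine hQ ?_
  rw [hcon]
  simp [collinear_empty]

theorem tropMonomial_sub (q r : ℤ × ℤ) (Q R : ℝ × ℝ) :
    (tropMonomial v F q Q - tropMonomial v F r Q) - (tropMonomial v F q R - tropMonomial v F r R) =
      ((q.1 : ℝ) - r.1) * (Q.1 - R.1) + ((q.2 : ℝ) - r.2) * (Q.2 - R.2) := by
  simp only [tropMonomial]; ring

theorem tropMonomial_eq_of_mem {q r : ℤ × ℤ} {Q : ℝ × ℝ} (hq : q ∈ dualPoints v F Q)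
    (hr : r ∈ dualPoints v F Q) : tropMonomial v F q Q = tropMonomial v F r Q := by
  rw [mem_dualPoints] at hq hr
  exact le_antisymm (hr.2 q hq.1) (hq.2 r hr.1)

/-- A vertex is determined by its dual points: if `Q ≠ R` had the same ones, all their differences
would be orthogonal to `Q - R`, making them collinear. -/
theorem finite_setOf_isVertex : {Q | IsVertex v F Q}.Finite := by
  refine Set.Finite.of_finite_image (f := dualPoints v F)
    ((F.support.powerset.finite_toSet).subset ?_) ?_
  · rintro _ ⟨Q, _, rfl⟩
    rw [Finset.mem_coe, Finset.mem_powerset, dualPoints]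
    exact Finset.filter_subset _ _
  · intro Q hQ R hR hQR
    by_contra hne
    obtain ⟨r, hr⟩ := IsVertex.nonempty_dualPoints hQ
    refine hQ (collinear_of_dot_eq (sub_ne_zero.2 hne)
      (c := (Q - R).1 * r.1 + (Q - R).2 * r.2) fun q hq => ?_)
    have h1 := tropMonomial_sub (v := v) (F := F) q r Q R
    have h2 := tropMonomial_eq_of_mem (Finset.mem_coe.1 hq) hr
    have h3 := tropMonomial_eq_of_mem (hQR ▸ Finset.mem_coe.1 hq) (hQR ▸ hr)
    rw [h2, h3] at h1
    simp only [Prod.fst_sub, Prod.snd_sub]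
    linarith

theorem convex_dualPoints_subset (B : Finset (ℤ × ℤ)) :
    Convex ℝ {Q | B ⊆ dualPoints v F Q} := by
  intro Q hQ R hR a b ha hb hab q hq
  have h1 := mem_dualPoints.1 (hQ hq)
  have h2 := mem_dualPoints.1 (hR hq)
  have haff : ∀ r, tropMonomial v F r (a • Q + b • R) =
      a * tropMonomial v F r Q + b * tropMonomial v F r R := fun r => by
    obtain rfl : b = 1 - a := by linarith
    simp [tropMonomial]
    ring
  refine mem_dualPoints.2 ⟨h1.1, fun r hr => ?_⟩
  rw [haff, haff]
  exact add_le_add (mul_le_mul_of_nonneg_left (h1.2 r hr) ha)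
    (mul_le_mul_of_nonneg_left (h2.2 r hr) hb)

theorem lineThrough_neg (P : ℝ × ℝ) (u : ℤ × ℤ) : lineThrough P (-u) = lineThrough P u := by
  have h : ∀ u : ℤ × ℤ, toPlane (-u) = -toPlane u := fun u => by simp [toPlane]
  ext Q
  constructor <;> rintro ⟨t, rfl⟩ <;> exact ⟨-t, by simp [h]⟩

theorem infl_neg : infl v F (-u) P = infl v F u P := by
  simp only [infl, dep, lineThrough_neg]

theorem exists_dualPoints_subset {t : ℝ} (ht : 0 < t) (hF : F.support.Nonempty) :
    ∃ s, 0 < s ∧ s < t ∧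
      dualPoints v F (P + s • toPlane u) ⊆ dualPoints v F (P + t • toPlane u) := by
  obtain ⟨q, hq⟩ := dualPoints_nonempty (v := v) hF (P + t • toPlane u)
  have hev : ∀ᶠ s in nhds t, ∀ r ∈ F.support, r ∉ dualPoints v F (P + t • toPlane u) →
      tropMonomial v F r (P + s • toPlane u) < tropMonomial v F q (P + s • toPlane u) := by
    rw [Finset.eventually_all]
    intro r hr
    by_cases hrt : r ∈ dualPoints v F (P + t • toPlane u)
    · simp [hrt]
    · have hlt : tropMonomial v F r (P + t • toPlane u) <
          tropMonomial v F q (P + t • toPlane u) := by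
        by_contra! hle
        exact hrt (mem_dualPoints.2 ⟨hr, fun r' hr' => ((mem_dualPoints.1 hq).2 r' hr').trans hle⟩)
      simp only [tropMonomial_add_smul] at hlt ⊢
      have hc : ∀ r : ℤ × ℤ,
          ContinuousAt (fun s : ℝ => tropMonomial v F r P + s * dot u r) t := fun r => by
        fun_prop
      filter_upwards [(hc r).eventually_lt (hc q) hlt] with s hs _ using hs
  have hev' := hev.filter_mono (nhdsWithin_le_nhds (s := Set.Iio t))
  obtain ⟨s, hs, hst⟩ := (hev'.and (Ioo_mem_nhdsLT ht)).exists
  refine ⟨s, hst.1, hst.2, fun r hr => ?_⟩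
  by_contra hrt
  have hr' := mem_dualPoints.1 hr
  exact absurd (hr'.2 q (mem_dualPoints.1 hq).1) (not_le.2 (hs r hr'.1 hrt))

/-- A vertex `P + t u`, `t > 0`, of the tropical curve lies in `infl_u(P)` if the superlevel set at
its left end is narrower than the multiplicity. -/
theorem mem_infl_of_levelWidth_lt (hu : u ≠ 0) (hP : IsVertex v F P)
    (hcol : ColumnBound F.support (fun q => tropMonomial v F q P) m u w) {t : ℝ} (ht : 0 < t)
    {q₁ q₂ : ℤ × ℤ} (hq₁ : q₁ ∈ dualPoints v F (P + t • toPlane u))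
    (hq₂ : q₂ ∈ dualPoints v F (P + t • toPlane u)) (h₁₂ : dot u q₁ < dot u q₂)
    (hW : levelWidth F.support (fun q => tropMonomial v F q P) u (tropMonomial v F q₁ P) < m) :
    P + t • toPlane u ∈ infl v F u P := by
  have hA : F.support.Nonempty := ⟨q₁, (mem_dualPoints.1 hq₁).1⟩
  have hpair : ∀ s : ℝ, 0 < s → ∀ q ∈ dualPoints v F (P + s • toPlane u),
      tropMonomial v F q₁ P ≤ tropMonomial v F q P →
      ∃ r₀ r₁, r₀ ∈ dualPoints v F (P + s • toPlane u) ∧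
        r₁ ∈ dualPoints v F (P + s • toPlane u) ∧
        dot u r₀ = dot u q ∧ dot u r₁ = dot u q ∧ r₀ ≠ r₁ := by
    intro s hs q hq hle
    simp only [mem_dualPoints_add_smul] at hq ⊢
    exact hcol.exists_ne hW hs hq.1 hq.2 hle
  -- By convexity in the parameter, the exponents maximal at `s < t` lie weakly to the left of `q₁`;
  -- being maximal at `s > 0`, they are then at least as high as `q₁`. So the column bound stays
  -- positive all the way from `P`.
  have hlevel : ∀ s : ℝ, 0 < s → s < t → ∀ q ∈ dualPoints v F (P + s • toPlane u),
      tropMonomial v F q₁ P ≤ tropMonomial v F q P := by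
    intro s hs hst q hq
    have h1 := (mem_dualPoints.1 hq).2 q₁ (mem_dualPoints.1 hq₁).1
    have h2 := (mem_dualPoints.1 hq₁).2 q (mem_dualPoints.1 hq).1
    simp only [tropMonomial_add_smul] at h1 h2
    have h3 : 0 ≤ (t - s) * ((dot u q₁ : ℝ) - dot u q) := by linarith
    have h4 := nonneg_of_mul_nonneg_right h3 (by linarith)
    have h5 := mul_nonneg hs.le h4
    linarith
  have htrop : ∀ s : ℝ, 0 ≤ s → s ≤ t → P + s • toPlane u ∈ tropCurve v F := by
    intro s hs hst
    rcases hs.eq_or_lt with rfl | hs0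
    · rw [zero_smul, add_zero]
      by_contra hcon
      rw [tropCurve, Set.mem_ofPred_eq, Set.not_nontrivial_iff] at hcon
      refine hP ?_
      rcases (hcon.image toPlane).eq_empty_or_singleton with h0 | ⟨z, hz⟩
      · rw [h0]; exact collinear_empty ℝ _
      · rw [hz]; exact collinear_singleton ℝ _
    · have hex : ∃ q ∈ dualPoints v F (P + s • toPlane u),
          tropMonomial v F q₁ P ≤ tropMonomial v F q P := by
        rcases hst.lt_or_eq with hlt | rfl
        · obtain ⟨q, hq⟩ := dualPoints_nonempty (v := v) hA (P + s • toPlane u)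
          exact ⟨q, hq, hlevel s hs0 hlt q hq⟩
        · exact ⟨q₁, hq₁, le_rfl⟩
      obtain ⟨q, hq, hle⟩ := hex
      obtain ⟨r₀, r₁, hr₀, hr₁, -, -, hne⟩ := hpair s hs0 q hq hle
      exact ⟨r₀, hr₀, r₁, hr₁, hne⟩
  have hvert : IsVertex v F (P + t • toPlane u) := by
    obtain ⟨r₀, r₁, hr₀, hr₁, he₀, he₁, hne⟩ := hpair t ht q₁ hq₁ le_rfl
    exact not_collinear_of_dot (u := u) hr₀ hr₁ hq₂ hne (he₀.trans he₁.symm)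
      (he₀.trans_lt h₁₂).ne
  -- `R` lies just before `P + t u`, and all monomials maximal at `R` remain maximal there. They
  -- form a single column with at least two exponents, so the cell of `R` is an edge lying on the
  -- line and containing `P + t u`.
  obtain ⟨s, hs0, hst, hsub⟩ := exists_dualPoints_subset (v := v) (P := P) (u := u) ht hA
  set R := P + s • toPlane u with hR
  have hRtrop : R ∈ tropCurve v F := htrop s hs0.le hst.le
  obtain ⟨q, hq⟩ := dualPoints_nonempty (v := v) hA R
  have hcolumn : ∀ r ∈ dualPoints v F R, dot u r = dot u q := by
    intro r hr
    have h1 := tropMonomial_eq_of_mem hr hq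
    have h2 := tropMonomial_eq_of_mem (hsub hr) (hsub hq)
    simp only [hR, tropMonomial_add_smul] at h1 h2
    have h3 : (t - s) * ((dot u r : ℝ) - dot u q) = 0 := by linarith
    have h4 := (mul_eq_zero.1 h3).resolve_left (by linarith)
    exact_mod_cast sub_eq_zero.1 h4
  have huR := toPlane_ne_zero hu
  have hRvert : ¬ IsVertex v F R := by
    rw [IsVertex, not_not]
    refine collinear_of_dot_eq huR (c := dot u q) fun r hr => ?_
    rw [← hcolumn r hr]
    simp [toPlane, dot]
  have hline : {Q | dualPoints v F R ⊆ dualPoints v F Q} ⊆ tropCurve v F ∩ lineThrough P u := by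
    intro Q hQ
    refine ⟨hRtrop.mono (Finset.coe_subset.2 hQ), ?_⟩
    obtain ⟨r₀, r₁, hr₀, hr₁, he₀, he₁, hne⟩ := hpair s hs0 q hq (hlevel s hs0 hst q hq)
    have h1 := tropMonomial_sub (v := v) (F := F) r₀ r₁ Q R
    rw [tropMonomial_eq_of_mem hr₀ hr₁, tropMonomial_eq_of_mem (hQ hr₀) (hQ hr₁), sub_self,
      sub_self, sub_self] at h1
    have h2 : (u.1 : ℝ) * (r₀.1 - r₁.1) + u.2 * (r₀.2 - r₁.2) = 0 := by
      have h3 : u.1 * (r₀.1 - r₁.1) + u.2 * (r₀.2 - r₁.2) = 0 := by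
        have := he₀.trans he₁.symm
        simp only [dot] at this
        linarith
      exact_mod_cast h3
    have h4 : ((r₀.1 : ℝ) - r₁.1) ^ 2 + (r₀.2 - r₁.2) ^ 2 ≠ 0 := fun h0 => by
      have h5 : (r₀.1 : ℝ) - r₁.1 = 0 := by
        nlinarith [sq_nonneg ((r₀.1 : ℝ) - r₁.1), sq_nonneg ((r₀.2 : ℝ) - r₁.2)]
      have h6 : (r₀.2 : ℝ) - r₁.2 = 0 := by
        nlinarith [sq_nonneg ((r₀.1 : ℝ) - r₁.1), sq_nonneg ((r₀.2 : ℝ) - r₁.2)]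
      exact hne (Prod.ext (by exact_mod_cast sub_eq_zero.1 h5)
        (by exact_mod_cast sub_eq_zero.1 h6))
    have h7 : (u.1 : ℝ) * (Q.2 - R.2) - u.2 * (Q.1 - R.1) = 0 := by
      refine (mul_eq_zero.1 (?_ : (((r₀.1 : ℝ) - r₁.1) ^ 2 + (r₀.2 - r₁.2) ^ 2) * _ = 0)
        ).resolve_left h4
      linear_combination ((r₀.1 - r₁.1) * (Q.2 - R.2) - (r₀.2 - r₁.2) * (Q.1 - R.1) : ℝ) * h2
        - ((r₀.2 - r₁.2) * u.1 - (r₀.1 - r₁.1) * u.2 : ℝ) * h1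
    have h8 : (u.1 : ℝ) ^ 2 + u.2 ^ 2 ≠ 0 := fun h0 => by
      have h5 : (u.1 : ℝ) = 0 := by nlinarith [sq_nonneg (u.1 : ℝ), sq_nonneg (u.2 : ℝ)]
      have h6 : (u.2 : ℝ) = 0 := by nlinarith [sq_nonneg (u.1 : ℝ), sq_nonneg (u.2 : ℝ)]
      exact huR (Prod.ext h5 h6)
    refine ⟨s + (u.1 * (Q.1 - R.1) + u.2 * (Q.2 - R.2)) / (u.1 ^ 2 + u.2 ^ 2), ?_⟩
    rw [add_smul, ← add_assoc, ← hR]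
    ext
    · simp only [toPlane, Prod.fst_add, Prod.smul_fst, smul_eq_mul]
      field_simp
      linear_combination -(u.2 : ℝ) * h7
    · simp only [toPlane, Prod.snd_add, Prod.smul_snd, smul_eq_mul]
      field_simp
      linear_combination (u.1 : ℝ) * h7
  have hsegsub : segment ℝ P (P + t • toPlane u) ⊆ tropCurve v F ∩ lineThrough P u := by
    intro Q hQ
    rw [segment_eq_image'] at hQ
    obtain ⟨θ, hθ, rfl⟩ := hQ
    have : P + θ • (P + t • toPlane u - P) = P + (θ * t) • toPlane u := by
      rw [add_sub_cancel_left, smul_smul]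
    simp only [this]
    exact ⟨htrop _ (mul_nonneg hθ.1 ht.le) (mul_le_of_le_one_left ht.le hθ.2), _, rfl⟩
  have hRmem : R ∈ connectedComponentIn (tropCurve v F ∩ lineThrough P u) P := by
    refine (convex_segment P (P + t • toPlane u)).isPreconnected.subset_connectedComponentIn
      (left_mem_segment ℝ _ _) hsegsub ?_
    rw [segment_eq_image']
    refine ⟨s / t, ⟨by positivity, (div_le_one ht).2 hst.le⟩, ?_⟩
    simp only [add_sub_cancel_left, smul_smul, div_mul_cancel₀ _ ht.ne', hR]
  refine ⟨hvert, _, ⟨⟨R, hRtrop, hRvert, rfl⟩, ?_⟩, hsub⟩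
  rw [connectedComponentIn_eq hRmem]
  exact (convex_dualPoints_subset _).isPreconnected.subset_connectedComponentIn
    (Finset.Subset.refl _) hline

end Valued

/-! ### Trapezoids inside the dual cells -/

/-- The trapezoid with vertical sides of lengths `L₁` and `L₂` over `α` and `β`, and with its lower
side on the horizontal axis. -/
def trapezoid (α β L₁ L₂ : ℝ) : Set (ℝ × ℝ) :=
  {p | α < p.1 ∧ p.1 < β ∧ 0 < p.2 ∧ p.2 * (β - α) ≤ L₁ * (β - p.1) + L₂ * (p.1 - α)}

theorem measurableSet_trapezoid (α β L₁ L₂ : ℝ) : MeasurableSet (trapezoid α β L₁ L₂) := by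
  have h₁ : MeasurableSet {p : ℝ × ℝ | α < p.1} := measurableSet_lt (by fun_prop) (by fun_prop)
  have h₂ : MeasurableSet {p : ℝ × ℝ | p.1 < β} := measurableSet_lt (by fun_prop) (by fun_prop)
  have h₃ : MeasurableSet {p : ℝ × ℝ | 0 < p.2} := measurableSet_lt (by fun_prop) (by fun_prop)
  have h₄ : MeasurableSet {p : ℝ × ℝ | p.2 * (β - α) ≤ L₁ * (β - p.1) + L₂ * (p.1 - α)} :=
    measurableSet_le (by fun_prop) (by fun_prop)
  exact h₁.inter (h₂.inter (h₃.inter h₄))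

theorem toPlane_eq {u w : ℤ × ℤ} (huw : u.1 * w.2 - u.2 * w.1 = 1) (q : ℤ × ℤ) :
    toPlane q = ((w.2 : ℝ) * dot u q - u.2 * dot w q, -(w.1 : ℝ) * dot u q + u.1 * dot w q) := by
  have h : (u.1 : ℝ) * w.2 - u.2 * w.1 = 1 := by exact_mod_cast huw
  simp only [toPlane, dot, Int.cast_add, Int.cast_mul]
  ext
  · linear_combination -(q.1 : ℝ) * h
  · linear_combination -(q.2 : ℝ) * h

/-- A convex set that contains two parallel lattice segments contains a unimodular image of a
trapezoid. -/
theorem volume_trapezoid_le {u w : ℤ × ℤ} (huw : u.1 * w.2 - u.2 * w.1 = 1) {S : Set (ℝ × ℝ)}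
    (hS : Convex ℝ S) {q₀ q₁ r₀ r₁ : ℤ × ℤ} (hq₀ : toPlane q₀ ∈ S) (hq₁ : toPlane q₁ ∈ S)
    (hr₀ : toPlane r₀ ∈ S) (hr₁ : toPlane r₁ ∈ S) (hq : dot u q₁ = dot u q₀)
    (hr : dot u r₁ = dot u r₀) (hqr : dot u q₀ < dot u r₀) :
    MeasureTheory.volume (trapezoid (dot u q₀) (dot u r₀) (dot w q₁ - dot w q₀)
      (dot w r₁ - dot w r₀)) ≤ MeasureTheory.volume S := by
  have hdet : (u.1 : ℝ) * w.2 - u.2 * w.1 = 1 := by exact_mod_cast huw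
  have hqr' : (0 : ℝ) < dot u r₀ - dot u q₀ := by
    have : (dot u q₀ : ℝ) < dot u r₀ := by exact_mod_cast hqr
    linarith
  rw [toPlane_eq huw] at hq₀ hq₁ hr₀ hr₁
  rw [hq] at hq₁
  rw [hr] at hr₁
  generalize (dot u q₀ : ℝ) = α at *
  generalize (dot u r₀ : ℝ) = β at *
  generalize (dot w q₀ : ℝ) = b₀ at *
  generalize (dot w q₁ : ℝ) = b₁ at *
  generalize (dot w r₀ : ℝ) = c₀ at *
  generalize (dot w r₁ : ℝ) = c₁ at *
  -- `s` is the slope of the lower side in the coordinates `(u · , w · )`. The map `T` composes the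
  -- lattice coordinate change with the shear that undoes the flattening of this side, so it has
  -- determinant `1`.
  obtain ⟨s, hs⟩ : ∃ s, s * (β - α) = c₀ - b₀ := ⟨(c₀ - b₀) / (β - α), div_mul_cancel₀ _ hqr'.ne'⟩
  set T : ℝ × ℝ →ₗ[ℝ] ℝ × ℝ := Matrix.toLin (Module.Basis.finTwoProd ℝ) (Module.Basis.finTwoProd ℝ)
    !![(w.2 : ℝ) - u.2 * s, -u.2; -w.1 + u.1 * s, u.1] with hT
  have hTdet : LinearMap.det T = 1 := by
    rw [hT, LinearMap.det_toLin, Matrix.det_fin_two_of]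
    linear_combination hdet
  set z : ℝ × ℝ := (-u.2 * (b₀ - s * α), u.1 * (b₀ - s * α)) with hz
  have hsub : trapezoid α β (b₁ - b₀) (c₁ - c₀) ⊆ T ⁻¹' ((fun p => p + z) ⁻¹' S) := by
    rintro ⟨x, σ⟩ ⟨hx₁, hx₂, hσ, hle⟩
    dsimp only at hx₁ hx₂ hσ hle
    obtain ⟨θ, hθ⟩ : ∃ θ, θ * (β - α) = x - α := ⟨(x - α) / (β - α), div_mul_cancel₀ _ hqr'.ne'⟩
    have hθ0 : 0 ≤ θ := nonneg_of_mul_nonneg_left (by linarith) hqr'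
    have hθ1 : 0 ≤ 1 - θ := nonneg_of_mul_nonneg_left (b := β - α) (by linarith) hqr'
    have hσle : σ ≤ (1 - θ) * (b₁ - b₀) + θ * (c₁ - c₀) := by
      refine le_of_mul_le_mul_right ?_ hqr'
      linear_combination hle + (b₁ - b₀ - (c₁ - c₀)) * hθ
    have hCpos := hσ.trans_le hσle
    -- `θ` is the relative position between the columns and `ρ` the relative height in the
    -- interpolated column, so the point is a two-step convex combination of the four corners.
    obtain ⟨ρ, hρ⟩ : ∃ ρ, ρ * ((1 - θ) * (b₁ - b₀) + θ * (c₁ - c₀)) = σ :=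
      ⟨σ / _, div_mul_cancel₀ _ hCpos.ne'⟩
    have hρ0 : 0 ≤ ρ := nonneg_of_mul_nonneg_left (by linarith) hCpos
    have hρ1 : 0 ≤ 1 - ρ := nonneg_of_mul_nonneg_left
      (b := (1 - θ) * (b₁ - b₀) + θ * (c₁ - c₀)) (by linarith) hCpos
    have hmem := hS (hS hq₀ hq₁ hρ1 hρ0 (by ring)) (hS hr₀ hr₁ hρ1 hρ0 (by ring)) hθ1 hθ0
      (by ring)
    have hxθ : x = α + θ * (β - α) := by linarith
    simp only [Set.mem_preimage]
    convert hmem using 1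
    rw [hT, Matrix.toLin_finTwoProd_apply, hz, hxθ, ← hρ]
    ext
    · simp only [Prod.fst_add, Prod.smul_fst, smul_eq_mul]
      linear_combination -(u.2 : ℝ) * θ * hs
    · simp only [Prod.snd_add, Prod.smul_snd, smul_eq_mul]
      linear_combination (u.1 : ℝ) * θ * hs
  refine (MeasureTheory.measure_mono hsub).trans ?_
  rw [MeasureTheory.Measure.addHaar_preimage_linearMap _ (by rw [hTdet]; exact one_ne_zero),
    hTdet, MeasureTheory.measure_preimage_add_right]
  simp

theorem convex_dualFace {K : Type*} [Field K] (v : Valuation K ℝᵐ⁰) (F : LaurentPoly K)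
    (Q : ℝ × ℝ) : Convex ℝ (dualFace v F Q) := convex_convexHull ℝ _

theorem toPlane_mem_dualFace {K : Type*} [Field K] {v : Valuation K ℝᵐ⁰} {F : LaurentPoly K}
    {Q : ℝ × ℝ} {q : ℤ × ℤ} (hq : q ∈ dualPoints v F Q) : toPlane q ∈ dualFace v F Q :=
  subset_convexHull ℝ _ (Set.mem_image_of_mem _ hq)

theorem volume_dualFace_lt_top {K : Type*} [Field K] (v : Valuation K ℝᵐ⁰) (F : LaurentPoly K)
    (Q : ℝ × ℝ) : MeasureTheory.volume (dualFace v F Q) < ⊤ :=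
  (((dualPoints v F Q).finite_toSet.image toPlane).isCompact_convexHull (𝕜 := ℝ)).measure_lt_top

/-- The interpolated column lengths over an edge of negative slope of the upper hull are at least
`m` minus the width of the superlevel sets. -/
theorem ColumnBound.exists_trapezoid {A : Finset (ℤ × ℤ)} {h : ℤ × ℤ → ℝ} {m : ℕ}
    {u w : ℤ × ℤ} (huw : u.1 * w.2 - u.2 * w.1 = 1) (hcol : ColumnBound A h m u w) {t : ℝ}
    (ht : 0 < t) {S : Set (ℝ × ℝ)} (hS : Convex ℝ S)
    (hAS : ∀ q ∈ A, h q + t * dot u q = maxAlong A h u t → toPlane q ∈ S) :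
    ∃ R : Set (ℝ × ℝ), MeasurableSet R ∧ MeasureTheory.volume R ≤ MeasureTheory.volume S ∧
      ∀ q₁ ∈ A, ∀ q₂ ∈ A, h q₁ + t * dot u q₁ = maxAlong A h u t →
        h q₂ + t * dot u q₂ = maxAlong A h u t → ∀ x σ μ : ℝ, (dot u q₁ : ℝ) < x → x < dot u q₂ →
        0 < σ → μ + t * x ≤ maxAlong A h u t → levelWidth A h u μ ≤ m - σ → (x, σ) ∈ R := by
  set B := A.filter fun r => h r + t * dot u r = maxAlong A h u t with hB
  rcases B.eq_empty_or_nonempty with hB0 | hBne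
  · refine ⟨∅, MeasurableSet.empty, by simp, fun q₁ hq₁ _ _ hm₁ => ?_⟩
    have : q₁ ∈ B := by rw [hB, Finset.mem_filter]; exact ⟨hq₁, hm₁⟩
    simp [hB0] at this
  obtain ⟨a, ha, hmin⟩ := B.exists_min_image (dot u) hBne
  obtain ⟨b, hb, hmax⟩ := B.exists_max_image (dot u) hBne
  rw [hB, Finset.mem_filter] at ha hb
  rcases (hmin b (by rw [hB, Finset.mem_filter]; exact hb)).eq_or_lt with heq | hlt
  · refine ⟨∅, MeasurableSet.empty, by simp, fun q₁ hq₁ q₂ hq₂ hm₁ hm₂ x σ μ h₁ h₂ => ?_⟩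
    have h3 := hmin q₁ (by rw [hB, Finset.mem_filter]; exact ⟨hq₁, hm₁⟩)
    have h4 := hmax q₂ (by rw [hB, Finset.mem_filter]; exact ⟨hq₂, hm₂⟩)
    have h5 : dot u q₁ < dot u q₂ := by exact_mod_cast h₁.trans h₂
    omega
  obtain ⟨a₀, ha₀, a₁, ha₁, hma₀, hma₁, hea₀, hea₁, -, hLa⟩ := hcol t ht a ha.1 ha.2
  obtain ⟨b₀, hb₀, b₁, hb₁, hmb₀, hmb₁, heb₀, heb₁, -, hLb⟩ := hcol t ht b hb.1 hb.2
  refine ⟨trapezoid (dot u a₀) (dot u b₀) (dot w a₁ - dot w a₀) (dot w b₁ - dot w b₀),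
    measurableSet_trapezoid _ _ _ _, volume_trapezoid_le huw hS (hAS _ ha₀ hma₀) (hAS _ ha₁ hma₁)
    (hAS _ hb₀ hmb₀) (hAS _ hb₁ hmb₁) (hea₁.trans hea₀.symm) (heb₁.trans heb₀.symm)
    (by rwa [hea₀, heb₀]), ?_⟩
  intro q₁ hq₁ q₂ hq₂ hm₁ hm₂ x σ μ h₁ h₂ hσ hμ hW
  rw [hea₀, heb₀]
  have h3 : (dot u a : ℝ) ≤ dot u q₁ := by
    exact_mod_cast hmin q₁ (by rw [hB, Finset.mem_filter]; exact ⟨hq₁, hm₁⟩)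
  have h4 : (dot u q₂ : ℝ) ≤ dot u b := by
    exact_mod_cast hmax q₂ (by rw [hB, Finset.mem_filter]; exact ⟨hq₂, hm₂⟩)
  have hd : (0 : ℝ) < dot u b - dot u a := by linarith
  refine ⟨by dsimp only; linarith, by dsimp only; linarith, hσ, ?_⟩
  dsimp only
  obtain ⟨θ, hθ⟩ : ∃ θ : ℝ, θ * (dot u b - dot u a) = x - dot u a :=
    ⟨(x - dot u a) / (dot u b - dot u a), div_mul_cancel₀ _ hd.ne'⟩
  have hθ0 : 0 ≤ θ := nonneg_of_mul_nonneg_left (by linarith) hd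
  have hθ1 : 0 ≤ 1 - θ := nonneg_of_mul_nonneg_left (b := dot u b - dot u a) (by linarith) hd
  have hA : A.Nonempty := ⟨a, ha.1⟩
  have hMa := le_maxHeight (h := h) ha.1
  have hMb := le_maxHeight (h := h) hb.1
  have hconc := (concaveOn_levelWidth hA h u).2 hMa hMb hθ1 hθ0 (by ring)
  simp only [smul_eq_mul] at hconc
  -- This is the height `ν` of the hull edge over `x`. The chain is: interpolated column length `≥ m
  -- - ((1 - θ) W (h a) + θ W (h b)) ≥ m - W ν ≥ m - W μ ≥ σ`, by the column bound, concavity and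
  -- monotonicity.
  have hν : (1 - θ) * h a + θ * h b = maxAlong A h u t - t * x := by
    linear_combination (1 - θ) * ha.2 + θ * hb.2 - t * hθ
  have hνM : (1 - θ) * h a + θ * h b ≤ maxHeight A h := by
    linarith [mul_le_mul_of_nonneg_left hMa hθ1, mul_le_mul_of_nonneg_left hMb hθ0]
  have hmono := levelWidth_anti (u := u) hA (show μ ≤ (1 - θ) * h a + θ * h b by linarith) hνM
  have hσle : σ ≤ (1 - θ) * (dot w a₁ - dot w a₀) + θ * (dot w b₁ - dot w b₀) := by
    linarith [mul_le_mul_of_nonneg_left hLa hθ1, mul_le_mul_of_nonneg_left hLb hθ0]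
  have := mul_le_mul_of_nonneg_right hσle hd.le
  linear_combination this - ((dot w a₁ : ℝ) - dot w a₀ - (dot w b₁ - dot w b₀)) * hθ

open MeasureTheory

/-! ### Lattice widths and primitive directions -/

section Width

theorem exists_latticeWidth_eq (u : ℤ × ℤ) {B : Finset (ℤ × ℤ)} (hB : B.Nonempty) :
    ∃ q₁ ∈ B, ∃ q₂ ∈ B, latticeWidth u B = dot u q₁ - dot u q₂ ∧
      ∀ q ∈ B, dot u q₂ ≤ dot u q ∧ dot u q ≤ dot u q₁ := by
  obtain ⟨q₁, hq₁, hmax⟩ := B.exists_max_image (dot u) hB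
  obtain ⟨q₂, hq₂, hmin⟩ := B.exists_min_image (dot u) hB
  have hsub : ∀ x y, dot u (x - y) = dot u x - dot u y := fun x y => by simp [dot]; ring
  refine ⟨q₁, hq₁, q₂, hq₂, IsGreatest.csSup_eq ⟨⟨q₁, hq₁, q₂, hq₂, (hsub _ _).symm⟩, ?_⟩,
    fun q hq => ⟨hmin q hq, hmax q hq⟩⟩
  rintro _ ⟨x, hx, y, hy, rfl⟩
  rw [hsub]
  exact sub_le_sub (hmax x hx) (hmin y hy)

theorem latticeWidth_le_of_smul {u : ℤ × ℤ} {g : ℤ} (hg : 0 < g) {B : Finset (ℤ × ℤ)}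
    (hB : B.Nonempty) : latticeWidth u B ≤ latticeWidth (g • u) B := by
  obtain ⟨q₁, hq₁, q₂, hq₂, hw, h₁₂⟩ := exists_latticeWidth_eq u hB
  obtain ⟨r₁, hr₁, r₂, hr₂, hw', hr⟩ := exists_latticeWidth_eq (g • u) hB
  have hdot : ∀ q, dot (g • u) q = g * dot u q := fun q => by simp [dot]; ring
  have h1 := (hr q₁ hq₁).2
  have h2 := (hr q₂ hq₂).1
  have h3 := (h₁₂ q₂ hq₂).2
  rw [hw, hw']
  simp only [hdot] at h1 h2 ⊢
  nlinarith

theorem exists_primitive {u : ℤ × ℤ} (hu : u ≠ 0) :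
    ∃ (g : ℤ) (u' w : ℤ × ℤ), 0 < g ∧ u = g • u' ∧ u'.1 * w.2 - u'.2 * w.1 = 1 := by
  have hg : 0 < Int.gcd u.1 u.2 := by
    rw [Int.gcd_pos_iff]
    by_contra! h
    exact hu (Prod.ext h.1 h.2)
  obtain ⟨g, a, b, hg0, hab, h1, h2⟩ := Int.exists_gcd_one' hg
  have hbez := Int.gcd_eq_gcd_ab a b
  rw [hab] at hbez
  refine ⟨g, (a, b), (-Int.gcdB a b, Int.gcdA a b), by exact_mod_cast hg0, ?_, ?_⟩
  · ext
    · simp [h1, mul_comm]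
    · simp [h2, mul_comm]
  · push_cast at hbez
    linarith

end Width

/-! ### Slicing the trapezoids and integrating -/

section Valued

variable {K : Type*} [Field K] {v : Valuation K ℝᵐ⁰} {F : LaurentPoly K} {P : ℝ × ℝ} {m : ℕ}
  {u w : ℤ × ℤ}

/-- The parameters `t > 0` of the points `P + t u` in `infl_u(P)`. -/
def inflParam (v : Valuation K ℝᵐ⁰) (F : LaurentPoly K) (u : ℤ × ℤ) (P : ℝ × ℝ) : Set ℝ :=
  {t | 0 < t ∧ P + t • toPlane u ∈ infl v F u P}

theorem add_smul_injective (hu : u ≠ 0) :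
    Function.Injective fun t : ℝ => P + t • toPlane u := fun _ _ hst =>
  smul_left_injective ℝ (toPlane_ne_zero hu) (add_left_cancel hst)

theorem finite_infl : (infl v F u P).Finite :=
  finite_setOf_isVertex.subset fun _ hQ => hQ.1

theorem finite_inflParam (hu : u ≠ 0) : (inflParam v F u P).Finite :=
  (finite_infl.preimage ((add_smul_injective hu).injOn)).subset fun _ ht => ht.2

/-- The trapezoids in the cells dual to the points of `infl_u(P)` on one side of `P` have at
height `σ` total width at least that of the corresponding part of a superlevel set. -/
theorem exists_layer (hu : u ≠ 0) (huw : u.1 * w.2 - u.2 * w.1 = 1) (hP : IsVertex v F P)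
    (hcol : ColumnBound F.support (fun q => tropMonomial v F q P) m u w) {a : ℝ}
    (ha : ∀ q ∈ dualPoints v F P, (dot u q : ℝ) ≤ a) :
    ∃ k : ℝ → ENNReal, Measurable k ∧
      ∫⁻ σ, k σ ≤ ∑ t ∈ (finite_inflParam (v := v) (F := F) (P := P) hu).toFinset,
        volume (dualFace v F (P + t • toPlane u)) ∧
      ∀ σ μ : ℝ, 0 < σ → μ ≤ maxHeight F.support (fun q => tropMonomial v F q P) →
        levelWidth F.support (fun q => tropMonomial v F q P) u μ = m - σ →
        ENNReal.ofReal (reach F.support (fun q => tropMonomial v F q P) u μ - a) ≤ k σ := by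
  set T := (finite_inflParam (v := v) (F := F) (P := P) hu).toFinset with hT
  have hreg : ∀ t : T, ∃ R : Set (ℝ × ℝ), MeasurableSet R ∧
      volume R ≤ volume (dualFace v F (P + (t : ℝ) • toPlane u)) ∧
      ∀ q₁ ∈ dualPoints v F (P + (t : ℝ) • toPlane u),
        ∀ q₂ ∈ dualPoints v F (P + (t : ℝ) • toPlane u), ∀ x σ μ : ℝ,
        (dot u q₁ : ℝ) < x → x < dot u q₂ → 0 < σ →
        μ + t * x ≤ maxAlong F.support (fun q => tropMonomial v F q P) u t →
        levelWidth F.support (fun q => tropMonomial v F q P) u μ ≤ m - σ → (x, σ) ∈ R := by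
    rintro ⟨t, ht⟩
    rw [hT, Set.Finite.mem_toFinset] at ht
    obtain ⟨R, hR, hvol, hmem⟩ := hcol.exists_trapezoid huw ht.1
      (convex_dualFace v F (P + t • toPlane u))
      (fun q hq hqt => toPlane_mem_dualFace (mem_dualPoints_add_smul.2 ⟨hq, hqt⟩))
    refine ⟨R, hR, hvol, fun q₁ hq₁ q₂ hq₂ => ?_⟩
    rw [mem_dualPoints_add_smul] at hq₁ hq₂
    exact hmem q₁ hq₁.1 q₂ hq₂.1 hq₁.2 hq₂.2
  choose R hRm hRvol hRmem using hreg
  -- `k σ` is the total length of the horizontal slices at height `σ`; by Tonelli its integral is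
  -- the total area of the trapezoids.
  refine ⟨fun σ => ∑ t : T, volume ((fun x => (x, σ)) ⁻¹' R t),
    Finset.measurable_sum _ fun t _ => measurable_measure_prodMk_right (hRm t), ?_, ?_⟩
  · rw [lintegral_finsetSum _ fun t _ => measurable_measure_prodMk_right (hRm t),
      ← Finset.sum_coe_sort T]
    refine Finset.sum_le_sum fun t _ => ?_
    rw [← Measure.prod_apply_symm (hRm t), ← Measure.volume_eq_prod]
    exact hRvol t
  · intro σ μ hσ hμ hW
    set A := F.support
    obtain ⟨q₀, hq₀⟩ : A.Nonempty :=
      hP.nonempty_dualPoints.mono fun q hq => (mem_dualPoints.1 hq).1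
    set ρ := reach A (fun q => tropMonomial v F q P) u μ with hρ
    set N : Set ℝ := (fun q => (dot u q : ℝ)) '' (A : Set (ℤ × ℤ)) with hN
    have hN0 : volume N = 0 := (A.finite_toSet.image _).measure_zero _
    -- Away from the null set `N` of projected exponents, each `x` lies strictly inside an edge of
    -- the hull. The left end of this edge is at height at least `μ`, where the width is less than
    -- `m`, so the corresponding vertex is in the influence set.
    have hcover : Set.Ioo a ρ ⊆ N ∪ ⋃ t ∈ (Finset.univ : Finset T), (fun x => (x, σ)) ⁻¹' R t := by
      intro x hx
      by_cases hxN : x ∈ N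
      · exact Or.inl hxN
      right
      obtain ⟨t, ht, q₁, hq₁, q₂, hq₂, hm₁, hm₂, h₁, h₂⟩ := exists_pos_eq_maxAlong
        (h := fun q => tropMonomial v F q P) ⟨q₀, hq₀⟩ hμ (fun q hq hqx => hxN ⟨q, hq, hqx⟩)
        (fun q hq hqM => (ha q (mem_dualPoints_iff_maxHeight.2 ⟨hq, hqM⟩)).trans_lt hx.1) hx.2
      have hq₁' : q₁ ∈ dualPoints v F (P + t • toPlane u) :=
        mem_dualPoints_add_smul.2 ⟨hq₁, hm₁⟩
      have hq₂' : q₂ ∈ dualPoints v F (P + t • toPlane u) :=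
        mem_dualPoints_add_smul.2 ⟨hq₂, hm₂⟩
      have hμt : μ + t * x ≤ maxAlong A (fun q => tropMonomial v F q P) u t := by
        have h3 := hx.2.trans_le (reach_le (u := u) ⟨q₀, hq₀⟩ hμ ht)
        rw [lt_div_iff₀ ht] at h3
        linarith
      have hμ₁ : μ ≤ tropMonomial v F q₁ P := by
        have := mul_lt_mul_of_pos_left h₁ ht
        linarith
      have hW₁ : levelWidth A (fun q => tropMonomial v F q P) u (tropMonomial v F q₁ P) < m := by
        have := levelWidth_anti (h := fun q => tropMonomial v F q P) (u := u) ⟨q₀, hq₀⟩ hμ₁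
          (le_maxHeight (h := fun q => tropMonomial v F q P) hq₁)
        linarith
      have hinfl := mem_infl_of_levelWidth_lt hu hP hcol ht hq₁' hq₂'
        (by exact_mod_cast h₁.trans h₂) hW₁
      have htT : t ∈ T := by
        rw [hT, Set.Finite.mem_toFinset]
        exact ⟨ht, hinfl⟩
      simp only [Set.mem_iUnion]
      exact ⟨⟨t, htT⟩, Finset.mem_univ _, hRmem ⟨t, htT⟩ q₁ hq₁' q₂ hq₂' x σ μ h₁ h₂ hσ hμt hW.le⟩
    rw [← Real.volume_Ioo]
    calc volume (Set.Ioo a ρ) ≤ volume N +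
          volume (⋃ t ∈ (Finset.univ : Finset T), (fun x => (x, σ)) ⁻¹' R t) :=
          (measure_mono hcover).trans (measure_union_le _ _)
      _ ≤ _ := by
          rw [hN0, zero_add]
          exact measure_biUnion_finset_le _ _

theorem sum_le_sum_infl (hu : u ≠ 0) (g : ℝ × ℝ → ENNReal)
    (hfin : (infl v F u P \ {P}).Finite) :
    ∑ t ∈ (finite_inflParam (v := v) (F := F) (P := P) hu).toFinset, g (P + t • toPlane u) +
      ∑ t ∈ (finite_inflParam (v := v) (F := F) (P := P) (neg_ne_zero.2 hu)).toFinset,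
        g (P + t • toPlane (-u)) ≤ ∑ Q ∈ hfin.toFinset, g Q := by
  classical
  rw [← Finset.sum_image (f := g) ((add_smul_injective (P := P) hu).injOn),
    ← Finset.sum_image (f := g) ((add_smul_injective (P := P) (neg_ne_zero.2 hu)).injOn),
    ← Finset.sum_union]
  · refine Finset.sum_le_sum_of_subset fun Q hQ => ?_
    rw [Finset.mem_union, Finset.mem_image, Finset.mem_image] at hQ
    have hne : ∀ (u : ℤ × ℤ) (t : ℝ), u ≠ 0 → 0 < t → P + t • toPlane u ≠ P :=
      fun u t hu ht h => by
        rw [add_eq_left, smul_eq_zero] at h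
        exact h.elim ht.ne' (toPlane_ne_zero hu)
    rw [Set.Finite.mem_toFinset]
    rcases hQ with ⟨t, ht, rfl⟩ | ⟨t, ht, rfl⟩
    · rw [Set.Finite.mem_toFinset] at ht
      exact ⟨ht.2, hne u t hu ht.1⟩
    · rw [Set.Finite.mem_toFinset] at ht
      exact ⟨infl_neg (v := v) (F := F) (u := u) ▸ ht.2, hne (-u) t (neg_ne_zero.2 hu) ht.1⟩
  · rw [Finset.disjoint_left]
    intro Q hQ hQ'
    rw [Finset.mem_image] at hQ hQ'
    obtain ⟨t, ht, rfl⟩ := hQ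
    obtain ⟨s, hs, hst⟩ := hQ'
    rw [Set.Finite.mem_toFinset] at ht hs
    have h1 : (s + t) • toPlane u = 0 := by
      have h2 : toPlane (-u) = -toPlane u := by simp [toPlane]
      have h3 := add_left_cancel hst
      rw [h2] at h3
      rw [add_smul, ← h3, smul_neg, add_neg_cancel]
    rw [smul_eq_zero] at h1
    exact h1.elim (add_pos hs.1 ht.1).ne' (toPlane_ne_zero hu)

theorem lintegral_Ioo_sub {c : ℝ} (hc : 0 ≤ c) :
    ∫⁻ σ in Set.Ioo 0 c, ENNReal.ofReal (c - σ) = ENNReal.ofReal (1 / 2 * c ^ 2) := by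
  rw [← ofReal_integral_eq_lintegral_ofReal]
  · rw [← integral_Ioc_eq_integral_Ioo, ← intervalIntegral.integral_of_le hc,
      intervalIntegral.integral_sub (by simp) (by simp)]
    simp only [intervalIntegral.integral_const, integral_id, smul_eq_mul]
    congr 1
    ring
  · have : Continuous fun σ : ℝ => c - σ := by fun_prop
    exact (this.integrableOn_Icc (a := 0) (b := c)).mono_set Set.Ioo_subset_Icc_self
  · refine (ae_restrict_iff' measurableSet_Ioo).2 (Filter.Eventually.of_forall fun σ hσ => ?_)
    simpa using hσ.2.le

/-- The area estimate in a primitive direction. -/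
theorem half_sq_le_sum_area (hu : u ≠ 0) (huw : u.1 * w.2 - u.2 * w.1 = 1)
    (hP : IsVertex v F P)
    (hcol : ColumnBound F.support (fun q => tropMonomial v F q P) m u w)
    (hcol' : ColumnBound F.support (fun q => tropMonomial v F q P) m (-u) (-w))
    (hadm : (m : ℤ) ≤ latticeWidth u F.support)
    (hwidth : latticeWidth u (dualPoints v F P) < m) (hfin : (infl v F u P \ {P}).Finite) :
    1 / 2 * ((m : ℝ) - latticeWidth u (dualPoints v F P)) ^ 2 ≤
      ∑ Q ∈ hfin.toFinset, area (dualFace v F Q) := by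
  have hB := hP.nonempty_dualPoints
  have hA : F.support.Nonempty := hB.mono fun q hq => (mem_dualPoints.1 hq).1
  obtain ⟨b₁, hb₁, b₂, hb₂, hbw, hb⟩ := exists_latticeWidth_eq u hB
  obtain ⟨q₁, hq₁, q₂, hq₂, hqw, -⟩ := exists_latticeWidth_eq u hA
  rw [hbw] at hwidth ⊢
  rw [hqw] at hadm
  have hadm' : (m : ℝ) ≤ dot u q₁ - dot u q₂ := by exact_mod_cast hadm
  have hwidth' : (dot u b₁ : ℝ) - dot u b₂ < m := by exact_mod_cast hwidth
  obtain ⟨k, hk, hkint, hkle⟩ := exists_layer hu huw hP hcol (a := dot u b₁)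
    (fun q hq => by exact_mod_cast (hb q hq).2)
  obtain ⟨k', hk', hkint', hkle'⟩ := exists_layer (neg_ne_zero.2 hu)
    (by simpa using huw) hP hcol' (a := -(dot u b₂ : ℝ))
    (fun q hq => by
      rw [dot_neg, Int.cast_neg, neg_le_neg_iff]
      exact_mod_cast (hb q hq).1)
  set c : ℝ := (m : ℝ) - (dot u b₁ - dot u b₂) with hc
  have hc0 : 0 ≤ c := by linarith
  -- At the level `μ` of width `m - σ`, the parts of the superlevel interval to the right of `u ·
  -- b₁` and to the left of `u · b₂` have signed lengths adding up to `c - σ`.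
  have hlayer : ∀ σ ∈ Set.Ioo 0 c, ENNReal.ofReal (c - σ) ≤ k σ + k' σ := by
    intro σ hσ
    obtain ⟨μ, hμ, hμW⟩ := exists_levelWidth_eq (h := fun q => tropMonomial v F q P) (u := u)
      (a := dot u b₁) (a' := -(dot u b₂ : ℝ)) (w := m - σ) hA
      (fun q hq hqM => by
        exact_mod_cast (hb q (mem_dualPoints_iff_maxHeight.2 ⟨hq, hqM⟩)).2)
      (fun q hq hqM => by
        rw [neg_le_neg_iff]
        exact_mod_cast (hb q (mem_dualPoints_iff_maxHeight.2 ⟨hq, hqM⟩)).1)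
      (by linarith [hσ.2]) hq₁ hq₂ (by linarith [hσ.1])
    have h1 := hkle σ μ hσ.1 hμ.le hμW
    have h2 := hkle' σ μ hσ.1 hμ.le (by rw [levelWidth_neg, hμW])
    refine le_trans ?_ ((ENNReal.ofReal_add_le).trans (add_le_add h1 h2))
    refine ENNReal.ofReal_le_ofReal ?_
    rw [levelWidth] at hμW
    linarith
  have harea : ∀ Q, 0 ≤ area (dualFace v F Q) := fun Q => measureReal_nonneg
  have hvol : ∑ Q ∈ hfin.toFinset, volume (dualFace v F Q) =
      ENNReal.ofReal (∑ Q ∈ hfin.toFinset, area (dualFace v F Q)) := by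
    rw [ENNReal.ofReal_sum_of_nonneg fun Q _ => harea Q]
    exact Finset.sum_congr rfl fun Q _ =>
      (ENNReal.ofReal_toReal (volume_dualFace_lt_top v F Q).ne).symm
  rw [Int.cast_sub, ← hc, ← ENNReal.ofReal_le_ofReal_iff (Finset.sum_nonneg fun Q _ => harea Q),
    ← hvol,
    ← lintegral_Ioo_sub hc0]
  calc ∫⁻ σ in Set.Ioo 0 c, ENNReal.ofReal (c - σ) ≤ ∫⁻ σ in Set.Ioo 0 c, (k σ + k' σ) :=
        setLIntegral_mono (hk.add hk') hlayer
    _ ≤ ∫⁻ σ, (k σ + k' σ) := setLIntegral_le_lintegral _ _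
    _ = (∫⁻ σ, k σ) + ∫⁻ σ, k' σ := lintegral_add_left hk _
    _ ≤ _ := (add_le_add hkint hkint').trans
        (sum_le_sum_infl hu (fun Q => volume (dualFace v F Q)) hfin)

theorem lineThrough_smul (P : ℝ × ℝ) (u : ℤ × ℤ) {g : ℤ} (hg : g ≠ 0) :
    lineThrough P (g • u) = lineThrough P u := by
  have h : toPlane (g • u) = (g : ℝ) • toPlane u := by simp [toPlane]
  have hg' : (g : ℝ) ≠ 0 := by exact_mod_cast hg
  ext Q
  constructor
  · rintro ⟨t, rfl⟩
    exact ⟨t * g, by rw [h, smul_smul]⟩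
  · rintro ⟨t, rfl⟩
    exact ⟨t / g, by rw [h, smul_smul, div_mul_cancel₀ _ hg']⟩

end Valued

end TropicalPlane

open TropicalPlane in
theorem mainTheorem6 {K : Type*} [Field K] (v : Valuation K (WithZero (Multiplicative ℝ)))
    (F : TropicalPlane.LaurentPoly K) (m : ℕ) (p₁ p₂ : K) (hp₁ : p₁ ≠ 0) (hp₂ : p₂ ≠ 0)
    (hmult : TropicalPlane.HasMultiplicity F p₁ p₂ m)
    (hadm : TropicalPlane.Admissible F m)
    (P : ℝ × ℝ) (hP : P = (TropicalPlane.val v p₁, TropicalPlane.val v p₂))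
    (hvert : TropicalPlane.IsVertex v F P)
    (u : ℤ × ℤ) (hu : u ≠ 0)
    (hedge : ∃ E, TropicalPlane.IsEdge v F E ∧ P ∈ E ∧ E ⊆ TropicalPlane.lineThrough P u)
    (hwidth : TropicalPlane.latticeWidth u (TropicalPlane.dualPoints v F P) < (m : ℤ)) :
    (TropicalPlane.infl v F u P \ {P}).Finite ∧
      (1 / 2 : ℝ) * (TropicalPlane.defect m u (TropicalPlane.dualPoints v F P) : ℝ) ^ 2 ≤
        ∑ᶠ Q ∈ TropicalPlane.infl v F u P \ {P},
          TropicalPlane.area (TropicalPlane.dualFace v F Q) := by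
  have hfin := (finite_infl (v := v) (F := F) (u := u) (P := P)).subset
    (Set.sdiff_subset (t := {P}))
  refine ⟨hfin, ?_⟩
  rw [finsum_mem_eq_finite_toFinset_sum _ hfin]
  -- Passing to the primitive direction `u'` keeps the line, hence the influence set, and does not
  -- increase the width of `d(P)`; the bound for `u'` is therefore at least as strong.
  obtain ⟨g, u', w, hg, rfl, huw⟩ := exists_primitive hu
  have hu' : u' ≠ 0 := right_ne_zero_of_smul hu
  have hB := hvert.nonempty_dualPoints
  have hle := latticeWidth_le_of_smul (u := u') hg hB
  have hinfl : infl v F (g • u') P = infl v F u' P := by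
    simp only [infl, dep, lineThrough_smul P u' hg.ne']
  simp only [hinfl] at hfin ⊢
  subst hP
  refine le_trans ?_ (half_sq_le_sum_area hu' huw hvert
    (columnBound_of_hasMultiplicity hp₁ hp₂ hmult huw)
    (columnBound_of_hasMultiplicity hp₁ hp₂ hmult (by simpa using huw))
    (hadm u' hu') (hle.trans_lt hwidth) hfin)
  have h1 : ((latticeWidth (g • u') (dualPoints v F (val v p₁, val v p₂)) : ℤ) : ℝ) < m := by
    exact_mod_cast hwidth
  have h2 : ((latticeWidth u' (dualPoints v F (val v p₁, val v p₂)) : ℤ) : ℝ) ≤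
      latticeWidth (g • u') (dualPoints v F (val v p₁, val v p₂)) := by exact_mod_cast hle
  rw [defect, max_eq_left (by linarith)]
  push_cast
  gcongr
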